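/- Let $\mathbb Z^{\rm cyc}\subset\mathbb C$ be the ring of cyclotomic integers (the subring generated by all roots of unity). A function $F$ of $q$ has $q$-expansion $\sum_k a_kq^k$ if $F(q)=\sum_{k\ge0}a_kq^k$, with convergence, for all $q$ in the domain specified below. **Moments.** For a real number $p>1$ (the case of interest, $S=\{p,\infty\}$, being $p$ prime) put $q=1/p$, $\Sigma_p(t)=\sum_{n>0}(p^{2n}e^{t}+e^{-t})^{-1/2}$ and $$c(2k,p)=(-1)^k\partial_x^{2k}\Big(\tfrac1{\sqrt{e^{-x}+e^{x}}}+\Sigma_p(x)+\Sigma_p(-x)\Big)_{x=0},\qquad c_0(2k)=(-1)^k\partial_x^{2k}\Big(\tfrac1{\sqrt{e^{-x}+e^{x}}}\Big)_{x=0},$$ with all odd moments equal to $0$. Let $D_n(q)$, respectively $D_n(0)$, be the determinant of the Hankel matrix of the moments $c(i+j,p)$, respectively $c_0(i+j)$, $0\le i,j\le n$. **Matrices.** Let $\alpha_\ell=(-4)^{-\ell}\binom{2\ell}{\ell}$, $$\mathcal P_m(x)=\sqrt{(2m)!}\sum_{k=0}^m(-1)^k2^{3k-m}\frac{\prod_{j=0}^{k-1}\left(j-\frac{ix}{2}+\frac14\right)}{(2k)!\,(m-k)!},\qquad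 \eta_\ell(m)=\mathcal P_m\!\left(-i\left(\tfrac12+2\ell\right)\right).$$ Let $\eta_\ell^+$ (respectively $\eta_\ell^-$) be the vector of the $\eta_\ell(m)$ with $m$ even (respectively odd), $0\le m\le n$, and for $|q|<1$ let $$\mathcal A_n^\pm(q)=\sum_{\ell\ge0}\alpha_\ell\frac{q^{2\ell+1}}{1-q^{2\ell+1}}\,T_\ell^\pm,\qquad T_\ell^\pm=\pm2^{3/2}\,|\eta_\ell^\pm\rangle\langle\eta_\ell^\pm| .$$ Let $\gamma_{i,j}(q)$, $0\le i,j\le n$, be the entries of $\mathcal A_n^+(q)\oplus\mathcal A_n^-(q)$, with rows and columns indexed by $\{0,\dots,n\}$. **Theorem.** For every integer $n\ge0$: (i) each $\gamma_{i,j}$ has a $q$-expansion, valid for all complex $q$ with $|q|<1$, whose coefficients belong to $\mathbb Z^{\rm cyc}[\tfrac12]$; (ii) for every integer $m\ge0$ the traces ${\rm Tr}(\wedge^m\mathcal A_n^{+})$ and ${\rm Tr}(\wedge^m\mathcal A_n^{-})$ have $q$-expansions, valid for all complex $q$ with $|q|<1$, whose coefficients belong to $\mathbb Z[1/\sqrt2]$;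 (iii) $D_n(0)\ne0$, and $D_n(q)/D_n(0)$ has a $q$-expansion with coefficients in $\mathbb Z[1/\sqrt2]$: there are $\mu_{n,k}\in\mathbb Z[1/\sqrt2]$, independent of $p$, such that $D_n(q)=D_n(0)\sum_{k\ge0}\mu_{n,k}q^k$ for $q=1/p$, for all real $p>1$, in particular for every prime $p$. -/

import Mathlib

open scoped ComplexConjugate

noncomputable section

namespace Semilocal

/-! ### Moments and Hankel determinants for the places `{p, ∞}` -/

/-- The archimedean generating function `1 / √(e^{-x} + e^x)`. -/
def archGen (x : ℝ) : ℝ := 1 / √(Real.exp (-x) + Real.exp x)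

/-- `Σ_p(t) = ∑_{n > 0} 1 / √(p^{2n} e^t + e^{-t})`. The parameter `p` is real; the case of
interest is `p` a prime number, and `q = 1/p`. -/
def primeGen (p t : ℝ) : ℝ :=
  ∑' n : ℕ, 1 / √(p ^ (2 * (n + 1)) * Real.exp t + Real.exp (-t))

/-- The un-normalised archimedean even moment `c₀(2k)`. -/
def archEvenMoment (k : ℕ) : ℝ := (-1) ^ k * iteratedDeriv (2 * k) archGen 0

/-- The un-normalised even moment `c(2k, p)` for the places `{p, ∞}`. -/
def evenMoment (p : ℝ) (k : ℕ) : ℝ :=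
  (-1) ^ k *
    iteratedDeriv (2 * k) (fun x => archGen x + primeGen p x + primeGen p (-x)) 0

/-- The Hankel matrix with entries `c(i+j)`, `0 ≤ i, j ≤ n`, for the sequence of moments whose
odd terms vanish and whose even terms are `c(2k) = e k`. -/
def evenHankel (e : ℕ → ℝ) (n : ℕ) : Matrix (Fin (n + 1)) (Fin (n + 1)) ℝ :=
  Matrix.of fun i j =>
    if Even ((i : ℕ) + (j : ℕ)) then e (((i : ℕ) + (j : ℕ)) / 2) else 0

/-- `D_n(q)` at `q = 1/p`. -/
def hankelDet (p : ℝ) (n : ℕ) : ℝ := (evenHankel (evenMoment p) n).det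

/-- `D_n(0)`: only the archimedean place contributes. -/
def hankelDetZero (n : ℕ) : ℝ := (evenHankel archEvenMoment n).det

/-! ### The matrices `A_n^±(q)` -/

/-- `α_ℓ = (-4)^{-ℓ} binom(2ℓ, ℓ)`, the Taylor coefficients of `1 / √(1 + x²)` in `x²`. -/
def alpha (l : ℕ) : ℂ := ((-4 : ℂ) ^ l)⁻¹ * (Nat.choose (2 * l) l : ℂ)

/-- The orthonormal polynomials of the normalised archimedean moments:
`P_m(x) = √((2m)!) ∑_{k=0}^m (-1)^k 2^{3k-m} ∏_{j<k} (j - ix/2 + 1/4) / ((2k)! (m-k)!)`. -/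
def orthoPoly (m : ℕ) : Polynomial ℂ :=
  Polynomial.C ((√((2 * m).factorial : ℝ) : ℝ) : ℂ) *
    ∑ k ∈ Finset.range (m + 1),
      Polynomial.C ((-1 : ℂ) ^ k * (2 : ℂ) ^ ((3 * k : ℤ) - (m : ℤ)) /
          (((2 * k).factorial : ℂ) * ((m - k).factorial : ℂ))) *
        ∏ j ∈ Finset.range k,
          (Polynomial.C (j : ℂ) - Polynomial.C (Complex.I / 2) * Polynomial.X
            + Polynomial.C (1 / 4 : ℂ))

/-- `η_ℓ(m) = P_m(-i(1/2 + 2ℓ))`. -/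
def eta (l m : ℕ) : ℂ := (orthoPoly m).eval (-Complex.I * (1 / 2 + 2 * (l : ℂ)))

/-- Indices of the coordinates of `H_n^+`: the even elements of `{0, …, n}`. -/
abbrev EvenIdx (n : ℕ) : Type := {i : Fin (n + 1) // Even (i : ℕ)}

/-- Indices of the coordinates of `H_n^-`: the odd elements of `{0, …, n}`. -/
abbrev OddIdx (n : ℕ) : Type := {i : Fin (n + 1) // ¬ Even (i : ℕ)}

/-- The vector `η_ℓ^+` of `H_n^+`. -/
def etaPlus (n l : ℕ) : EvenIdx n → ℂ := fun i => eta l (i : Fin (n + 1))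

/-- The vector `η_ℓ^-` of `H_n^-`. -/
def etaMinus (n l : ℕ) : OddIdx n → ℂ := fun i => eta l (i : Fin (n + 1))

/-- The rank one operator `T_ℓ^+ = 2^{3/2} |η_ℓ^+⟩⟨η_ℓ^+|`. -/
def TPlus (n l : ℕ) : Matrix (EvenIdx n) (EvenIdx n) ℂ :=
  (((2 : ℝ) ^ (3 / 2 : ℝ) : ℝ) : ℂ) • Matrix.vecMulVec (etaPlus n l) (star (etaPlus n l))

/-- The rank one operator `T_ℓ^- = -2^{3/2} |η_ℓ^-⟩⟨η_ℓ^-|`. -/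
def TMinus (n l : ℕ) : Matrix (OddIdx n) (OddIdx n) ℂ :=
  (-(((2 : ℝ) ^ (3 / 2 : ℝ) : ℝ) : ℂ)) •
    Matrix.vecMulVec (etaMinus n l) (star (etaMinus n l))

/-- The Lambert series `A_n^+(q) = ∑_ℓ α_ℓ q^{2ℓ+1} / (1 - q^{2ℓ+1}) T_ℓ^+`. -/
def APlus (n : ℕ) (q : ℂ) : Matrix (EvenIdx n) (EvenIdx n) ℂ :=
  ∑' l : ℕ, (alpha l * (q ^ (2 * l + 1) / (1 - q ^ (2 * l + 1)))) • TPlus n l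

/-- The Lambert series `A_n^-(q) = ∑_ℓ α_ℓ q^{2ℓ+1} / (1 - q^{2ℓ+1}) T_ℓ^-`. -/
def AMinus (n : ℕ) (q : ℂ) : Matrix (OddIdx n) (OddIdx n) ℂ :=
  ∑' l : ℕ, (alpha l * (q ^ (2 * l + 1) / (1 - q ^ (2 * l + 1)))) • TMinus n l

/-- The matrix `A_n^+(q) ⊕ A_n^-(q)`, with its rows and columns indexed by `{0, …, n}`; its
entries are the `γ_{i,j}(q)`. -/
def gammaMatrix (n : ℕ) (q : ℂ) : Matrix (Fin (n + 1)) (Fin (n + 1)) ℂ :=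
  Matrix.reindex (Equiv.sumCompl fun i : Fin (n + 1) => Even (i : ℕ))
    (Equiv.sumCompl fun i : Fin (n + 1) => Even (i : ℕ))
    (Matrix.fromBlocks (APlus n q) 0 0 (AMinus n q))

/-- `Tr(⋀^m A)`, the trace of the `m`-th exterior power of the operator with matrix `A`. -/
def traceWedge {ι : Type} [Fintype ι] [DecidableEq ι] (m : ℕ) (A : Matrix ι ι ℂ) : ℂ :=
  LinearMap.trace ℂ (⋀[ℂ]^m (ι → ℂ)) (exteriorPower.map m (Matrix.toLin' A))

/-! ### Coefficient rings and `q`-expansions -/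

/-- The ring `ℤ^cyc` of cyclotomic integers: generated by all roots of unity. -/
def cyclotomicIntegers : Subalgebra ℤ ℂ :=
  Algebra.adjoin ℤ {z : ℂ | ∃ n : ℕ, 0 < n ∧ z ^ n = 1}

/-- The ring `ℤ^cyc[1/2]`. -/
def cyclotomicIntegersHalf : Subalgebra ℤ ℂ :=
  Algebra.adjoin ℤ ((cyclotomicIntegers : Set ℂ) ∪ {(1 / 2 : ℂ)})

/-- The ring `ℤ[1/√2]`. -/
def intInvSqrtTwo : Subalgebra ℤ ℂ :=
  Algebra.adjoin ℤ {(((1 / √2 : ℝ)) : ℂ)}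

/-- The function `F` is, on the open unit disc, the sum of a power series in `q` (its
`q`-expansion, which is then unique) all of whose coefficients lie in `R`. -/
def HasQExpansionIn (R : Subalgebra ℤ ℂ) (F : ℂ → ℂ) : Prop :=
  ∃ a : ℕ → ℂ, (∀ k, a k ∈ R) ∧ ∀ q : ℂ, ‖q‖ < 1 → HasSum (fun k => a k * q ^ k) (F q)

end Semilocal

end

/-! Up to the scalar √binom(2m,m)/2^m, P_m is a polynomial Q_m (`meixnerPoly`) whose value at the
node -i(1/2+2ℓ) is M(m,ℓ) = ₂F₁(-m,-ℓ;1/2;2). Everything arithmetic rests on two facts: M is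
symmetric (`meixner_comm`), and binom(2m,m) M(m,ℓ) is an integer (`centralBinom_mul_meixner`), so
that binom(2ℓ,ℓ) M(m,ℓ) is one too.

For (i), the Lambert coefficient α_ℓ 2^{3/2} η_ℓ(i) η_ℓ(j) is, up to sign and powers of √2, the
square root of a natural number (`sqrt_centralBinom_mul`), hence a cyclotomic integer up to powers
of 2, by Gauss sums. For (ii), traces of exterior powers are sums of principal minors, so they do
not change under conjugation by the diagonal matrix of the scalars above. This replaces
√(binom(2i,i) binom(2j,j)) by binom(2j,j); the factor binom(2ℓ,ℓ) of α_ℓ clears M(i,ℓ), binom(2j,j)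
clears M(j,ℓ), and only powers of √2 remain (`gammaCoeff_conj_mem`). Since M(m,ℓ) grows polynomially
in ℓ, the Lambert series converge absolutely on the disc and can be regrouped by powers of q.

For (iii), the archimedean moment functional is P ↦ P(i∂)`archGen` at 0. Since Q_m(i∂)`archGen` =
`archGen`·tanh^m (`archSymbol_meixnerPoly`), the three-term recurrence makes the Q_m orthogonal,
with explicit nonzero norms. The binomial series turns Σ_p(x) into a combination of the exponentials
e^{-(1/2+2ℓ)x}, so the finite place adds point masses at plus and minus the nodes
(`hasSum_momentFunctional_sub`). In the basis Q_m the quotient D_n(q)/D_n(0) is the determinant of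
the identity plus a matrix of Lambert series over ℤ[1/√2] (`hankelDet_div`). -/

namespace Semilocal

/-! ### Meixner polynomials of parameters `(1/2, -1)` -/

/-- The integer `4 ^ N * binom(k + N - 1/2, N)`, i.e. the coefficient of `t ^ N` in
`(1 - 4 t) ^ (-k - 1/2)`. -/
def halfBinom : ℕ → ℕ → ℕ
  | 0, N => N.centralBinom
  | _ + 1, 0 => 1
  | k + 1, N + 1 => halfBinom k (N + 1) + 4 * halfBinom (k + 1) N

/-- With m = k + N this exhibits binom(2m,m) binom(m,k) / binom(2k,k) as an integer, which is what
removes the denominators of `meixner`. -/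
theorem halfBinom_mul_centralBinom (k N : ℕ) :
    halfBinom k N * k.centralBinom = (k + N).centralBinom * (k + N).choose k := by
  induction k generalizing N with
  | zero => simp [halfBinom]
  | succ k ihk =>
    induction N with
    | zero => simp [halfBinom]
    | succ N ihN =>
      have h1 := ihk (N + 1)
      have h2 := Nat.succ_mul_centralBinom_succ k
      have h3 := Nat.succ_mul_centralBinom_succ (k + N + 1)
      have h4 := Nat.choose_succ_right_eq (k + N + 1) k
      have h5 := Nat.add_one_mul_choose_eq (k + N + 1) k
      have e1 : k + N + 1 - k = N + 1 := by omega
      rw [e1] at h4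
      have e2 : k + 1 + (N + 1) = k + N + 1 + 1 := by ring
      have e3 : k + 1 + N = k + N + 1 := by ring
      have e4 : k + (N + 1) = k + N + 1 := by ring
      rw [e3] at ihN
      rw [e4] at h1
      rw [e2, halfBinom]
      apply Nat.eq_of_mul_eq_mul_left (Nat.succ_pos k)
      zify at *
      linear_combination (halfBinom k (N + 1) : ℤ) * h2 + (2 * (2 * (k : ℤ) + 1)) * h1 +
        4 * ((k : ℤ) + 1) * ihN + 4 * ((k + N + 1).centralBinom : ℤ) * h4 -
        ((k + N + 1).choose k : ℤ) * h3 + ((k + N + 1 + 1).centralBinom : ℤ) * h5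

/-- The values `₂F₁(-m, -l; 1/2; 2)` of the Meixner polynomials. -/
noncomputable def meixner (m l : ℕ) : ℝ :=
  ∑ k ∈ Finset.range (m + 1),
    (m.choose k : ℝ) * (8 ^ k / (k.centralBinom : ℝ)) * (l.choose k : ℝ)

theorem meixner_eq_sum_range {m N : ℕ} (l : ℕ) (h : m ≤ N) :
    meixner m l = ∑ k ∈ Finset.range (N + 1),
      (m.choose k : ℝ) * (8 ^ k / (k.centralBinom : ℝ)) * (l.choose k : ℝ) := by
  refine Finset.sum_subset (Finset.range_mono (by omega)) fun k _ hk => ?_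
  rw [Nat.choose_eq_zero_of_lt (by simpa using hk)]
  simp

/-- Self-duality: the central binomial coefficient of either the degree or the node clears the
denominators. -/
theorem meixner_comm (m l : ℕ) : meixner m l = meixner l m := by
  rw [meixner_eq_sum_range l (Nat.le_add_right m l), meixner_eq_sum_range m (Nat.le_add_left l m)]
  exact Finset.sum_congr rfl fun k _ => by ring

theorem meixner_nonneg (m l : ℕ) : 0 ≤ meixner m l :=
  Finset.sum_nonneg fun k _ => by positivity

/-- The integer `binom(2m, m) * ₂F₁(-m, -l; 1/2; 2)`. -/
def meixnerNat (m l : ℕ) : ℕ :=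
  ∑ k ∈ Finset.range (m + 1), 8 ^ k * halfBinom k (m - k) * l.choose k

theorem centralBinom_mul_meixner (m l : ℕ) :
    (m.centralBinom : ℝ) * meixner m l = meixnerNat m l := by
  rw [meixner, meixnerNat, Finset.mul_sum]
  push_cast
  refine Finset.sum_congr rfl fun k hk => ?_
  have hk : k ≤ m := by simpa [Nat.lt_succ_iff] using hk
  have h : (halfBinom k (m - k) : ℝ) * k.centralBinom = m.centralBinom * m.choose k := by
    have := halfBinom_mul_centralBinom k (m - k)
    rw [Nat.add_sub_cancel' hk] at this
    exact_mod_cast this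
  have h0 : (k.centralBinom : ℝ) ≠ 0 := by exact_mod_cast k.centralBinom_ne_zero
  field_simp
  linear_combination -(l.choose k : ℝ) * h

theorem exists_meixner_le (m : ℕ) :
    ∃ C : ℝ, ∀ l : ℕ, meixner m l ≤ C * ((l : ℝ) + 1) ^ m := by
  refine ⟨∑ k ∈ Finset.range (m + 1), (m.choose k : ℝ) * (8 ^ k / (k.centralBinom : ℝ)),
    fun l => ?_⟩
  rw [meixner, Finset.sum_mul]
  refine Finset.sum_le_sum fun k hk => ?_
  have hk : k ≤ m := by simpa [Nat.lt_succ_iff] using hk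
  gcongr
  calc (l.choose k : ℝ) ≤ (l : ℝ) ^ k := by exact_mod_cast Nat.choose_le_pow l k
    _ ≤ ((l : ℝ) + 1) ^ k := by gcongr; linarith
    _ ≤ ((l : ℝ) + 1) ^ m := by
      gcongr
      linarith [Nat.cast_nonneg (α := ℝ) l]

/-! ### The polynomials -/

open Polynomial in
/-- The product `∏_{j<k} (j - ix/2 + 1/4)`. -/
noncomputable def risingPoly (k : ℕ) : ℂ[X] :=
  ∏ j ∈ Finset.range k, (C (j : ℂ) - C (Complex.I / 2) * X + C (1 / 4 : ℂ))

/-- The coefficient of `risingPoly k` in `meixnerPoly m`. -/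
noncomputable def meixnerCoeff (m k : ℕ) : ℂ :=
  (m.choose k : ℂ) * (8 ^ k / (k.centralBinom : ℂ)) * ((-1) ^ k / (k.factorial : ℂ))

open Polynomial in
/-- The Meixner–Pollaczek polynomials, normalised by the value `1` at `-i/2`. -/
noncomputable def meixnerPoly (m : ℕ) : ℂ[X] :=
  ∑ k ∈ Finset.range (m + 1), C (meixnerCoeff m k) * risingPoly k

theorem sqrt_factorial_two_mul (m : ℕ) :
    √((2 * m).factorial : ℝ) = √(m.centralBinom : ℝ) * m.factorial := by
  have h : ((2 * m).factorial : ℝ) = m.centralBinom * (m.factorial : ℝ) ^ 2 := by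
    have := Nat.choose_mul_factorial_mul_factorial (n := 2 * m) (k := m) (by omega)
    rw [show 2 * m - m = m by omega] at this
    rw [Nat.centralBinom, ← this]
    push_cast
    ring
  rw [h, Real.sqrt_mul (by positivity), Real.sqrt_sq (by positivity)]

/-- The normalisation factor of `P_m`. -/
noncomputable def orthoNorm (m : ℕ) : ℝ := √(m.centralBinom : ℝ) / 2 ^ m

theorem orthoNorm_sq (m : ℕ) : orthoNorm m ^ 2 = (m.centralBinom : ℝ) / 4 ^ m := by
  rw [orthoNorm, div_pow, Real.sq_sqrt (by positivity), ← pow_mul, mul_comm m 2, pow_mul]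
  norm_num

theorem orthoNorm_pos (m : ℕ) : 0 < orthoNorm m := by
  have := m.centralBinom_pos
  unfold orthoNorm
  positivity

/-- Since √(2m)! = m! √binom(2m,m), the only irrationality of P_m sits in a scalar. -/
theorem orthoPoly_eq (m : ℕ) :
    orthoPoly m = Polynomial.C ((orthoNorm m : ℝ) : ℂ) * meixnerPoly m := by
  rw [orthoPoly, meixnerPoly, Finset.mul_sum, Finset.mul_sum]
  refine Finset.sum_congr rfl fun k hk => ?_
  have hk : k ≤ m := by simpa [Nat.lt_succ_iff] using hk
  rw [← mul_assoc, ← mul_assoc, ← Polynomial.C_mul, ← Polynomial.C_mul, risingPoly]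
  congr 2
  rw [sqrt_factorial_two_mul, orthoNorm, meixnerCoeff]
  have h1 : (m.choose k : ℂ) * k.factorial * (m - k).factorial = m.factorial := by
    exact_mod_cast Nat.choose_mul_factorial_mul_factorial hk
  have h2 : (k.centralBinom : ℂ) * k.factorial * k.factorial = (2 * k).factorial := by
    have := Nat.choose_mul_factorial_mul_factorial (n := 2 * k) (k := k) (by omega)
    rw [show 2 * k - k = k by omega] at this
    exact_mod_cast this
  have n1 : (k.factorial : ℂ) ≠ 0 := by exact_mod_cast k.factorial_ne_zero
  have n2 : ((m - k).factorial : ℂ) ≠ 0 := by exact_mod_cast (m - k).factorial_ne_zero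
  have n3 : (k.centralBinom : ℂ) ≠ 0 := by exact_mod_cast k.centralBinom_ne_zero
  have h3 : (2 : ℂ) ^ ((3 * k : ℤ) - (m : ℤ)) = 8 ^ k / 2 ^ m := by
    rw [zpow_sub₀ two_ne_zero, zpow_natCast, zpow_mul, zpow_natCast]
    norm_num
  rw [h3, ← h2]
  push_cast
  rw [← h1]
  field_simp

open Polynomial in
theorem risingPoly_succ (k : ℕ) :
    risingPoly (k + 1) = risingPoly k * (C (k : ℂ) - C (Complex.I / 2) * X + C (1 / 4 : ℂ)) :=
  Finset.prod_range_succ _ _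

/-- At this node the factor j - ix/2 + 1/4 becomes j - l. -/
theorem risingPoly_eval (k l : ℕ) :
    (risingPoly k).eval (-Complex.I * (1 / 2 + 2 * (l : ℂ))) =
      (-1) ^ k * ((k.factorial : ℂ) * (l.choose k : ℂ)) := by
  induction k with
  | zero => simp [risingPoly]
  | succ k ih =>
    rw [risingPoly_succ, Polynomial.eval_mul, ih]
    have h : ((k.factorial : ℂ) * (l.choose k : ℂ)) * ((l : ℂ) - k) =
        ((k + 1).factorial : ℂ) * (l.choose (k + 1) : ℂ) := by
      have h1 := Nat.choose_succ_right_eq l k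
      rw [Nat.factorial_succ]
      push_cast
      rcases le_or_gt k l with hkl | hkl
      · have : ((l - k : ℕ) : ℂ) = (l : ℂ) - k := Nat.cast_sub hkl
        rw [← this]
        have h1' : (l.choose (k + 1) : ℂ) * (k + 1) = l.choose k * ((l - k : ℕ) : ℂ) := by
          exact_mod_cast h1
        linear_combination -(k.factorial : ℂ) * h1'
      · rw [Nat.choose_eq_zero_of_lt hkl, Nat.choose_eq_zero_of_lt (by omega)]
        simp
    rw [← h]
    simp only [Polynomial.eval_add, Polynomial.eval_sub, Polynomial.eval_mul, Polynomial.eval_C,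
      Polynomial.eval_X]
    linear_combination ((-1) ^ k * ((k.factorial : ℂ) * (l.choose k : ℂ)) * (1/4 + l)) *
      Complex.I_sq

theorem meixnerPoly_eval (m l : ℕ) :
    (meixnerPoly m).eval (-Complex.I * (1 / 2 + 2 * (l : ℂ))) = (meixner m l : ℂ) := by
  rw [meixnerPoly, meixner, Polynomial.eval_finsetSum]
  push_cast
  refine Finset.sum_congr rfl fun k _ => ?_
  rw [Polynomial.eval_mul, Polynomial.eval_C, risingPoly_eval, meixnerCoeff]
  have n1 : (k.factorial : ℂ) ≠ 0 := by exact_mod_cast k.factorial_ne_zero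
  have h : ((-1 : ℂ) ^ k) * (-1) ^ k = 1 := by rw [← mul_pow]; simp
  field_simp
  linear_combination ((m.choose k : ℂ) * (l.choose k : ℂ) * (k.centralBinom : ℂ)⁻¹) * h

theorem eta_eq (l m : ℕ) : eta l m = ((orthoNorm m * meixner m l : ℝ) : ℂ) := by
  rw [eta, orthoPoly_eq, Polynomial.eval_mul, Polynomial.eval_C, meixnerPoly_eval]
  push_cast
  rfl

open Polynomial in
theorem X_mul_risingPoly (k : ℕ) :
    C Complex.I * X * risingPoly k =
      C (2 * (k : ℂ) + 1 / 2) * risingPoly k - C 2 * risingPoly (k + 1) := by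
  rw [risingPoly_succ]
  have h1 : (C Complex.I : ℂ[X]) = C 2 * C (Complex.I / 2) := by rw [← C_mul]; congr 1; ring
  have h2 : (C (2 * (k : ℂ) + 1 / 2) : ℂ[X]) = C 2 * (C (k : ℂ) + C (1 / 4)) := by
    rw [← C_add, ← C_mul]; congr 1; ring
  rw [h1, h2]
  ring

/-- The three-term recurrence of `meixnerPoly`, read off in the basis `risingPoly`, on which
multiplication by iX is bidiagonal. -/
theorem meixnerCoeff_recurrence (m k : ℕ) :
    ((m : ℂ) + 3 / 2) * meixnerCoeff (m + 2) (k + 1) =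
      (2 * ((k + 1 : ℕ) : ℂ) + 1 / 2) * meixnerCoeff (m + 1) (k + 1) - 2 * meixnerCoeff (m + 1) k +
        ((m : ℂ) + 1) * meixnerCoeff m (k + 1) := by
  simp only [meixnerCoeff]
  have h1 : ((k : ℂ) + 1) * (k + 1).centralBinom = 2 * (2 * k + 1) * k.centralBinom := by
    exact_mod_cast Nat.succ_mul_centralBinom_succ k
  have n1 : (k.factorial : ℂ) ≠ 0 := by exact_mod_cast k.factorial_ne_zero
  have n3 : (k.centralBinom : ℂ) ≠ 0 := by exact_mod_cast k.centralBinom_ne_zero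
  have n4 : ((k : ℂ) + 1) ≠ 0 := by exact_mod_cast k.succ_ne_zero
  have n5 : (2 * (k : ℂ) + 1) ≠ 0 := by exact_mod_cast (2 * k).succ_ne_zero
  have h1' : ((k + 1).centralBinom : ℂ) = 2 * (2 * k + 1) * k.centralBinom / (k + 1) := by
    field_simp
    linear_combination h1
  have h2 : ((m + 2).choose (k + 1) : ℂ) = (m + 1).choose k + (m + 1).choose (k + 1) := by
    exact_mod_cast Nat.choose_succ_succ (m + 1) k
  have h3 : ((m + 1).choose (k + 1) : ℂ) = m.choose k + m.choose (k + 1) := by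
    exact_mod_cast Nat.choose_succ_succ m k
  have h4 : (m + 1 : ℂ) * m.choose k = (m + 1).choose (k + 1) * (k + 1) := by
    exact_mod_cast Nat.add_one_mul_choose_eq m k
  have h5 : ((m + 1).choose (k + 1) : ℂ) * (k + 1) = (m + 1).choose k * (m + 1 - k) := by
    rcases le_or_gt k (m + 1) with hk | hk
    · have := Nat.choose_succ_right_eq (m + 1) k
      have e : ((m + 1 - k : ℕ) : ℂ) = (m : ℂ) + 1 - k := by push_cast [Nat.cast_sub hk]; ring
      rw [← e]
      exact_mod_cast this
    · rw [Nat.choose_eq_zero_of_lt hk, Nat.choose_eq_zero_of_lt (by omega)]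
      simp
  have h6 : (m.choose (k + 1) : ℂ) = (m + 1).choose (k + 1) - m.choose k := by rw [h3]; ring
  rw [h1', h2, Nat.factorial_succ, h6]
  push_cast
  -- Every binomial coefficient is now expressed through `(m + 1).choose k`, leaving a rational
  -- identity.
  have h5' : ((m + 1).choose (k + 1) : ℂ) = (m + 1).choose k * (m + 1 - k) / (k + 1) := by
    field_simp
    linear_combination h5
  have h4' : (m.choose k : ℂ) = (m + 1).choose k * (m + 1 - k) / (m + 1) := by
    have : (m + 1 : ℂ) ≠ 0 := by exact_mod_cast m.succ_ne_zero
    field_simp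
    linear_combination h4 + h5
  have : (m + 1 : ℂ) ≠ 0 := by exact_mod_cast m.succ_ne_zero
  rw [h4', h5']
  field_simp
  ring

open Polynomial in
theorem meixnerPoly_eq_sum_range {m N : ℕ} (h : m ≤ N) :
    meixnerPoly m = ∑ k ∈ Finset.range (N + 1), C (meixnerCoeff m k) * risingPoly k := by
  refine Finset.sum_subset (Finset.range_mono (by omega)) fun k _ hk => ?_
  rw [meixnerCoeff, Nat.choose_eq_zero_of_lt (by simpa using hk)]
  simp

open Polynomial in
theorem meixnerPoly_zero : meixnerPoly 0 = 1 := by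
  simp [meixnerPoly, meixnerCoeff, risingPoly]

open Polynomial in
theorem meixnerPoly_one : C (1 / 2) * meixnerPoly 1 = C Complex.I * X := by
  have h := X_mul_risingPoly 0
  have h0 : risingPoly 0 = 1 := Finset.prod_range_zero _
  have c0 : meixnerCoeff 1 0 = 1 := by simp [meixnerCoeff]
  have c1 : meixnerCoeff 1 1 = -4 := by
    norm_num [meixnerCoeff, Nat.centralBinom]
  have hC : (C (1 / 2) : ℂ[X]) * C (-4) = -C 2 := by rw [← C_mul, ← C_neg]; norm_num
  rw [meixnerPoly, Finset.sum_range_succ, Finset.sum_range_one, c0, c1]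
  rw [h0] at h ⊢
  simp only [Nat.cast_zero, mul_zero, zero_add, mul_one, C_1] at h ⊢
  rw [h, mul_add, ← mul_assoc, hC]
  ring

open Polynomial in
theorem meixnerPoly_recurrence (m : ℕ) :
    C ((m : ℂ) + 3 / 2) * meixnerPoly (m + 2) =
      C Complex.I * X * meixnerPoly (m + 1) + C ((m : ℂ) + 1) * meixnerPoly m := by
  have key : C Complex.I * X * meixnerPoly (m + 1) =
      ∑ k ∈ Finset.range (m + 3), C ((2 * (k : ℂ) + 1 / 2) * meixnerCoeff (m + 1) k) * risingPoly k
      - ∑ k ∈ Finset.range (m + 2), C (2 * meixnerCoeff (m + 1) k) * risingPoly (k + 1) := by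
    rw [Finset.sum_range_succ _ (m + 2)]
    have : meixnerCoeff (m + 1) (m + 2) = 0 := by
      rw [meixnerCoeff, Nat.choose_eq_zero_of_lt (by omega)]
      simp
    rw [this, mul_zero, C_0, zero_mul, add_zero, meixnerPoly, Finset.mul_sum,
      ← Finset.sum_sub_distrib]
    refine Finset.sum_congr rfl fun k _ => ?_
    rw [mul_left_comm, X_mul_risingPoly]
    simp only [C_mul]
    ring
  rw [key, meixnerPoly_eq_sum_range (show m ≤ m + 2 by omega), meixnerPoly,
    Finset.mul_sum, Finset.mul_sum, Finset.sum_range_succ' _ (m + 2), Finset.sum_range_succ' _ (m + 2),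
    Finset.sum_range_succ' _ (m + 2)]
  -- The terms of index k + 1 are matched with one another, the constant terms separately.
  have e : ∀ a b c d f : ℂ[X], a + b - c + (d + f) = (a - c + d) + (b + f) := by intros; ring
  rw [e, ← Finset.sum_sub_distrib, ← Finset.sum_add_distrib]
  congr 1
  · refine Finset.sum_congr rfl fun k _ => ?_
    rw [← mul_assoc, ← mul_assoc, ← C_mul, ← C_mul, meixnerCoeff_recurrence]
    simp only [C_add, C_sub]
    ring
  · rw [← mul_assoc, ← mul_assoc, ← C_mul, ← C_mul, ← add_mul, ← C_add]
    congr 2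
    simp [meixnerCoeff]
    ring

/-- The recurrence preserves parity. It is needed because Σ_p(x) + Σ_p(-x) brings in a node and its
opposite. -/
theorem meixnerPoly_eval_neg (m : ℕ) (z : ℂ) :
    (meixnerPoly m).eval (-z) = (-1) ^ m * (meixnerPoly m).eval z := by
  induction m using Nat.twoStepInduction with
  | zero => simp [meixnerPoly_zero]
  | one =>
    have h1 := congrArg (Polynomial.eval z) meixnerPoly_one
    have h2 := congrArg (Polynomial.eval (-z)) meixnerPoly_one
    simp only [Polynomial.eval_mul, Polynomial.eval_C, Polynomial.eval_X] at h1 h2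
    linear_combination 2 * h2 + 2 * h1
  | more m ih1 ih2 =>
    have h1 := congrArg (Polynomial.eval z) (meixnerPoly_recurrence m)
    have h2 := congrArg (Polynomial.eval (-z)) (meixnerPoly_recurrence m)
    simp only [Polynomial.eval_mul, Polynomial.eval_C, Polynomial.eval_X, Polynomial.eval_add]
      at h1 h2
    have hm : (m : ℂ) + 3 / 2 ≠ 0 := by
      have : (2 * m + 3 : ℂ) ≠ 0 := by exact_mod_cast (2 * m + 2).succ_ne_zero
      intro h
      apply this
      linear_combination 2 * h
    apply mul_left_cancel₀ hm
    rw [h2, ih1, ih2]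
    linear_combination -(-1) ^ m * h1

theorem natDegree_meixnerPoly_le (m : ℕ) : (meixnerPoly m).natDegree ≤ m := by
  refine Polynomial.natDegree_sum_le_of_forall_le _ _ fun k hk => ?_
  have hk : k ≤ m := by simpa [Nat.lt_succ_iff] using hk
  refine (Polynomial.natDegree_C_mul_le _ _).trans ((Polynomial.natDegree_prod_le _ _).trans ?_)
  refine (Finset.sum_le_card_nsmul _ _ 1 fun j _ => ?_).trans (by simpa using hk)
  compute_degree

/-! ### The ring of functions with a `q`-expansion -/

namespace HasQExpansionIn

variable {R : Subalgebra ℤ ℂ} {F G : ℂ → ℂ}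

theorem const {c : ℂ} (hc : c ∈ R) : HasQExpansionIn R (fun _ => c) := by
  refine ⟨fun k => if k = 0 then c else 0, fun k => ?_, fun q _ => ?_⟩
  · dsimp only
    split_ifs
    exacts [hc, R.zero_mem]
  · convert hasSum_ite_eq 0 c using 2 with k
    split_ifs with h <;> simp [h]

theorem congr (hF : HasQExpansionIn R F) (h : ∀ q : ℂ, ‖q‖ < 1 → G q = F q) :
    HasQExpansionIn R G := by
  obtain ⟨a, ha, hF⟩ := hF
  exact ⟨a, ha, fun q hq => h q hq ▸ hF q hq⟩

theorem add (hF : HasQExpansionIn R F) (hG : HasQExpansionIn R G) :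
    HasQExpansionIn R (F + G) := by
  obtain ⟨a, ha, hF⟩ := hF
  obtain ⟨b, hb, hG⟩ := hG
  refine ⟨a + b, fun k => R.add_mem (ha k) (hb k), fun q hq => ?_⟩
  simpa [add_mul] using (hF q hq).add (hG q hq)

theorem neg (hF : HasQExpansionIn R F) : HasQExpansionIn R (-F) := by
  obtain ⟨a, ha, hF⟩ := hF
  refine ⟨-a, fun k => R.neg_mem (ha k), fun q hq => ?_⟩
  simpa using (hF q hq).neg

theorem mul (hF : HasQExpansionIn R F) (hG : HasQExpansionIn R G) :
    HasQExpansionIn R (F * G) := by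
  obtain ⟨a, ha, hF⟩ := hF
  obtain ⟨b, hb, hG⟩ := hG
  refine ⟨fun n => ∑ k ∈ Finset.range (n + 1), a k * b (n - k),
    fun k => R.sum_mem fun _ _ => R.mul_mem (ha _) (hb _), fun q hq => ?_⟩
  have h := hasSum_sum_range_mul_of_summable_norm (hF q hq).summable.norm (hG q hq).summable.norm
  rw [(hF q hq).tsum_eq, (hG q hq).tsum_eq] at h
  have e : ∀ n, ∑ k ∈ Finset.range (n + 1), a k * q ^ k * (b (n - k) * q ^ (n - k)) =
      (∑ k ∈ Finset.range (n + 1), a k * b (n - k)) * q ^ n := by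
    intro n
    rw [Finset.sum_mul]
    refine Finset.sum_congr rfl fun k hk => ?_
    have hk : k ≤ n := by simpa [Nat.lt_succ_iff] using hk
    rw [mul_mul_mul_comm, ← pow_add, Nat.add_sub_cancel' hk]
  simp only [e] at h
  exact h

variable (R) in
/-- The ring of functions with a `q`-expansion with coefficients in `R`. -/
def subring : Subring (ℂ → ℂ) where
  carrier := {F | HasQExpansionIn R F}
  mul_mem' := mul
  one_mem' := const R.one_mem
  add_mem' := add
  zero_mem' := const R.zero_mem
  neg_mem' := neg

theorem sum {ι : Type*} (s : Finset ι) {f : ι → ℂ → ℂ} (h : ∀ i ∈ s, HasQExpansionIn R (f i)) :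
    HasQExpansionIn R (fun q => ∑ i ∈ s, f i q) := by
  have := (subring R).sum_mem h
  rwa [show (fun q => ∑ i ∈ s, f i q) = ∑ i ∈ s, f i by ext q; simp]

theorem det {ι : Type*} [Fintype ι] [DecidableEq ι] {B : ℂ → Matrix ι ι ℂ}
    (h : ∀ i j, HasQExpansionIn R (fun q => B q i j)) :
    HasQExpansionIn R (fun q => (B q).det) := by
  have h1 : (fun q => (B q).det) =
      ∑ σ : Equiv.Perm ι, ((Equiv.Perm.sign σ : ℤ)) • ∏ i, (fun q => B q (σ i) i) := by
    ext q
    simp [Matrix.det_apply']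
  rw [h1]
  exact (subring R).sum_mem fun σ _ => (subring R).zsmul_mem
    ((subring R).prod_mem fun i _ => h _ _) _

end HasQExpansionIn

/-! ### Lambert series -/

/-- Sequences of at most polynomial growth. -/
def PolyGrowth (b : ℕ → ℂ) : Prop :=
  ∃ (C : ℝ) (N : ℕ), ∀ l : ℕ, ‖b l‖ ≤ C * ((l : ℝ) + 1) ^ N

theorem PolyGrowth.mul {a b : ℕ → ℂ} (ha : PolyGrowth a) (hb : PolyGrowth b) :
    PolyGrowth (fun l => a l * b l) := by
  obtain ⟨C, N, ha⟩ := ha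
  obtain ⟨D, M, hb⟩ := hb
  refine ⟨C * D, N + M, fun l => ?_⟩
  rw [norm_mul, pow_add, mul_mul_mul_comm]
  exact mul_le_mul (ha l) (hb l) (norm_nonneg _) ((norm_nonneg _).trans (ha l))

theorem PolyGrowth.of_norm_le {b : ℕ → ℂ} {C : ℝ} (h : ∀ l, ‖b l‖ ≤ C) : PolyGrowth b :=
  ⟨C, 0, by simpa using h⟩

theorem PolyGrowth.summable_mul_pow {b : ℕ → ℂ} (hb : PolyGrowth b) {r : ℝ} (h0 : 0 ≤ r)
    (h1 : r < 1) : Summable fun l => ‖b l‖ * r ^ l := by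
  obtain ⟨C, N, hb⟩ := hb
  have hC : 0 ≤ C := by simpa using (norm_nonneg _).trans (hb 0)
  have hs : Summable fun l : ℕ => (((l : ℝ) + 1) ^ N * r ^ l) := by
    rcases h0.eq_or_lt with rfl | hr
    · refine summable_of_ne_finset_zero (s := {0}) fun l hl => ?_
      simp [show l ≠ 0 by simpa using hl]
    · have := summable_pow_mul_geometric_of_norm_lt_one N (r := r)
        (by rwa [Real.norm_of_nonneg h0])
      have := ((summable_nat_add_iff 1).mpr this).mul_left r⁻¹
      refine this.congr fun l => ?_
      push_cast
      rw [pow_succ]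
      field_simp
  refine Summable.of_nonneg_of_le (fun l => by positivity) (fun l => ?_) (hs.mul_left C)
  rw [← mul_assoc]
  gcongr
  exact hb l

/-- As (2l+1)(n+1) ≥ l + n, the double series is dominated by a product of two convergent series. -/
theorem PolyGrowth.summable_prod {b : ℕ → ℂ} (hb : PolyGrowth b) {q : ℂ} (hq : ‖q‖ < 1) :
    Summable fun x : ℕ × ℕ => b x.1 * q ^ ((2 * x.1 + 1) * (x.2 + 1)) := by
  have h := (hb.summable_mul_pow (norm_nonneg q) hq).mul_of_nonneg
    (summable_geometric_of_lt_one (norm_nonneg q) hq) (fun _ => by positivity)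
    (fun _ => by positivity)
  refine Summable.of_norm_bounded h fun x => ?_
  rw [norm_mul, norm_pow, mul_assoc, ← pow_add]
  gcongr ‖b x.1‖ * ?_
  refine pow_le_pow_of_le_one (norm_nonneg q) hq.le ?_
  nlinarith [Nat.zero_le (x.1 * x.2)]

theorem hasSum_lambert_term (c : ℂ) {q : ℂ} (hq : ‖q‖ < 1) (l : ℕ) :
    HasSum (fun n : ℕ => c * q ^ ((2 * l + 1) * (n + 1)))
      (c * (q ^ (2 * l + 1) / (1 - q ^ (2 * l + 1)))) := by
  have h1 : ‖q ^ (2 * l + 1)‖ < 1 := by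
    rw [norm_pow]
    exact pow_lt_one₀ (norm_nonneg q) hq (by omega)
  have := ((hasSum_geometric_of_norm_lt_one h1).mul_left (q ^ (2 * l + 1))).mul_left c
  rw [div_eq_mul_inv]
  simpa only [pow_succ', pow_mul] using this

theorem PolyGrowth.hasSum_lambert {b : ℕ → ℂ} (hb : PolyGrowth b) {q : ℂ} (hq : ‖q‖ < 1) :
    HasSum (fun l => b l * (q ^ (2 * l + 1) / (1 - q ^ (2 * l + 1))))
      (∑' x : ℕ × ℕ, b x.1 * q ^ ((2 * x.1 + 1) * (x.2 + 1))) :=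
  (hb.summable_prod hq).hasSum.prod_fiberwise fun l => hasSum_lambert_term (b l) hq l

/-- Regrouping the absolutely convergent double series by exponent, the coefficient of q^k is the
sum of b_l over the odd divisors 2l+1 of k for k ≥ 1, and an empty sum for k = 0. -/
theorem PolyGrowth.hasQExpansionIn_lambert {R : Subalgebra ℤ ℂ} {b : ℕ → ℂ} (hb : PolyGrowth b)
    (hR : ∀ l, b l ∈ R) :
    HasQExpansionIn R fun q => ∑' l, b l * (q ^ (2 * l + 1) / (1 - q ^ (2 * l + 1))) := by
  let e : ℕ × ℕ → ℕ := fun x => (2 * x.1 + 1) * (x.2 + 1)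
  have hfin : ∀ k, Finite (e ⁻¹' {k}) := by
    intro k
    refine Set.Finite.subset ((Finset.range (k + 1) ×ˢ Finset.range (k + 1)).finite_toSet) ?_
    rintro ⟨l, n⟩ h
    have h : (2 * l + 1) * (n + 1) = k := h
    simp only [Finset.coe_product, Finset.coe_range, Set.mem_prod, Set.mem_Iio]
    constructor <;> nlinarith [Nat.zero_le (l * n)]
  have : ∀ k, Fintype (e ⁻¹' {k}) := fun k => Fintype.ofFinite _
  refine ⟨fun k => ∑ x : e ⁻¹' {k}, b x.1.1, fun k => R.sum_mem fun x _ => hR _,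
    fun q hq => ?_⟩
  dsimp only
  rw [(hb.hasSum_lambert hq).tsum_eq]
  have h := (Equiv.sigmaFiberEquiv e).hasSum_iff.mpr (hb.summable_prod hq).hasSum
  refine h.sigma fun k => ?_
  convert hasSum_fintype _ using 1
  · rw [Finset.sum_mul]
    refine Finset.sum_congr rfl fun x _ => ?_
    have : (2 * x.1.1 + 1) * (x.1.2 + 1) = k := x.2
    simp [Equiv.sigmaFiberEquiv, this]

/-! ### Traces of exterior powers and principal minors -/

theorem traceWedge_eq_sum_det {ι : Type} [Fintype ι] [LinearOrder ι] (m : ℕ)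
    (A : Matrix ι ι ℂ) :
    traceWedge m A = ∑ s : Set.powersetCard ι m,
      (Matrix.of fun i j => A (Set.powersetCard.ofFinEmbEquiv.symm s j)
        (Set.powersetCard.ofFinEmbEquiv.symm s i)).det := by
  rw [traceWedge, LinearMap.trace_eq_matrix_trace ℂ ((Pi.basisFun ℂ ι).exteriorPower m),
    Matrix.trace]
  refine Finset.sum_congr rfl fun s _ => ?_
  rw [Matrix.diag_apply, LinearMap.toMatrix_apply, exteriorPower.basis_apply,
    exteriorPower.basis_repr_apply, exteriorPower.ιMulti_family, exteriorPower.map_apply_ιMulti,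
    exteriorPower.ιMultiDual_apply_ιMulti]
  congr 1
  ext i j
  simp

/-- Each principal minor is multiplied by the product of the d_i and by that of their inverses. -/
theorem traceWedge_diag_conj {ι : Type} [Fintype ι] [LinearOrder ι] (m : ℕ)
    (A B : Matrix ι ι ℂ) (d : ι → ℂ) (hd : ∀ i, d i ≠ 0)
    (h : ∀ i j, B i j = (d i)⁻¹ * A i j * d j) : traceWedge m A = traceWedge m B := by
  rw [traceWedge_eq_sum_det, traceWedge_eq_sum_det]
  refine Finset.sum_congr rfl fun s _ => ?_
  set e := Set.powersetCard.ofFinEmbEquiv.symm s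
  have h1 : (Matrix.of fun i j => B (e j) (e i)).det =
      (∏ i, d (e i)) * ((∏ i, (d (e i))⁻¹) * (Matrix.of fun i j => A (e j) (e i)).det) := by
    rw [← Matrix.det_mul_row (fun j => (d (e j))⁻¹), ← Matrix.det_mul_column (fun i => d (e i))]
    congr 1
    ext i j
    simp only [Matrix.of_apply, h]
    ring
  rw [h1, ← mul_assoc, ← Finset.prod_mul_distrib]
  simp [hd]

theorem HasQExpansionIn.traceWedge {R : Subalgebra ℤ ℂ} {ι : Type} [Fintype ι] [LinearOrder ι]
    (m : ℕ) {B : ℂ → Matrix ι ι ℂ} (h : ∀ i j, HasQExpansionIn R (fun q => B q i j)) :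
    HasQExpansionIn R (fun q => traceWedge m (B q)) := by
  simp only [traceWedge_eq_sum_det]
  exact HasQExpansionIn.sum _ fun s _ => HasQExpansionIn.det fun i j => h _ _

/-! ### Square roots of natural numbers -/

theorem mem_cyclotomicIntegers {z : ℂ} {n : ℕ} (hn : 0 < n) (h : z ^ n = 1) :
    z ∈ cyclotomicIntegers :=
  Algebra.subset_adjoin ⟨n, hn, h⟩

theorem I_mem_cyclotomicIntegers : Complex.I ∈ cyclotomicIntegers :=
  mem_cyclotomicIntegers (n := 4) (by norm_num) Complex.I_pow_four

theorem mem_cyclotomicIntegers_of_sq_eq {z w : ℂ} (hw : w ∈ cyclotomicIntegers)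
    (h : z ^ 2 = w ^ 2) : z ∈ cyclotomicIntegers := by
  rcases sq_eq_sq_iff_eq_or_eq_neg.mp h with rfl | rfl
  exacts [hw, neg_mem hw]

/-- For odd p the quadratic Gauss sum has square χ(-1)p; a factor i corrects the sign when χ(-1) =
-1. -/
theorem exists_sq_eq_prime (p : ℕ) (hp : p.Prime) : ∃ w ∈ cyclotomicIntegers, w ^ 2 = (p : ℂ) := by
  rcases hp.eq_two_or_odd with rfl | hodd
  · obtain ⟨z, hz⟩ := IsAlgClosed.exists_pow_nat_eq Complex.I (n := 2) (by norm_num)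
    have h8 : z ^ 8 = 1 := by
      rw [show 8 = 2 * 4 by norm_num, pow_mul, hz, Complex.I_pow_four]
    have hzm := mem_cyclotomicIntegers (by norm_num) h8
    -- Here z ^ 7 is the inverse of z, and (z + z⁻¹)² = i + 2 - i.
    refine ⟨z + z ^ 7, add_mem hzm (pow_mem hzm 7), ?_⟩
    have h14 : z ^ 14 = z ^ 6 := by rw [show 14 = 8 + 6 by norm_num, pow_add, h8, one_mul]
    have h6 : z ^ 6 = - z ^ 2 := by
      rw [show 6 = 2 * 3 by norm_num, pow_mul, hz, Complex.I_pow_three]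
    push_cast
    linear_combination 2 * h8 + h14 + h6
  · have : Fact p.Prime := ⟨hp⟩
    have hchar : ringChar (ZMod p) ≠ 2 := by
      rw [ZMod.ringChar_zmod_n]
      rintro rfl
      omega
    let χ : MulChar (ZMod p) ℂ := (quadraticChar (ZMod p)).ringHomComp (Int.castRingHom ℂ)
    have hχ1 : χ ≠ 1 := by
      intro h
      exact quadraticChar_ne_one hchar
        ((MulChar.ringHomComp_eq_one_iff Int.cast_injective).mp h)
    have hχ2 : χ.IsQuadratic := (quadraticChar_isQuadratic (ZMod p)).comp _
    have hsq := gaussSum_sq hχ1 hχ2 (ZMod.isPrimitive_stdAddChar p)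
    rw [ZMod.card] at hsq
    have hg : gaussSum χ (ZMod.stdAddChar (N := p)) ∈ cyclotomicIntegers := by
      refine sum_mem fun a _ => mul_mem ?_ ?_
      · exact intCast_mem _ _
      · refine mem_cyclotomicIntegers hp.pos ?_
        rw [← AddChar.map_nsmul_eq_pow]
        simp
    rcases hχ2 (-1) with h | h | h
    · have h1 : χ (-1) * χ (-1) = 1 := by rw [← map_mul]; simp
      simp [h] at h1
    · exact ⟨_, hg, by rw [hsq, h, one_mul]⟩
    · refine ⟨_, mul_mem I_mem_cyclotomicIntegers hg, ?_⟩
      rw [mul_pow, hsq, h, Complex.I_sq]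
      ring

theorem sqrt_natCast_mem_cyclotomicIntegers (n : ℕ) :
    ((√(n : ℝ) : ℝ) : ℂ) ∈ cyclotomicIntegers := by
  induction n using Nat.recOnMul with
  | zero => simp
  | one => simp
  | prime p hp =>
    obtain ⟨w, hw, h⟩ := exists_sq_eq_prime p hp
    refine mem_cyclotomicIntegers_of_sq_eq hw ?_
    rw [h, ← Complex.ofReal_pow, Real.sq_sqrt (Nat.cast_nonneg p)]
    simp
  | mul a b ha hb =>
    rw [Nat.cast_mul, Real.sqrt_mul (Nat.cast_nonneg a), Complex.ofReal_mul]
    exact mul_mem ha hb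

/-! ### The coefficients of the matrices `A_n^±` -/

theorem half_mem_intInvSqrtTwo : (1 / 2 : ℂ) ∈ intInvSqrtTwo := by
  have h : (((1 / √2 : ℝ)) : ℂ) ∈ intInvSqrtTwo := Algebra.subset_adjoin rfl
  have h2 := pow_mem h 2
  rw [← Complex.ofReal_pow, div_pow, Real.sq_sqrt zero_le_two] at h2
  simpa using h2

theorem sqrt_two_mem_intInvSqrtTwo : ((√2 : ℝ) : ℂ) ∈ intInvSqrtTwo := by
  have h : (((1 / √2 : ℝ)) : ℂ) ∈ intInvSqrtTwo := Algebra.subset_adjoin rfl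
  have h2 := mul_mem (natCast_mem intInvSqrtTwo 2) h
  convert h2 using 1
  rw [← Complex.ofReal_natCast, ← Complex.ofReal_mul]
  congr 1
  field_simp
  norm_num

theorem half_mem_cyclotomicIntegersHalf : (1 / 2 : ℂ) ∈ cyclotomicIntegersHalf :=
  Algebra.subset_adjoin (Or.inr rfl)

theorem cyclotomicIntegers_le : cyclotomicIntegers ≤ cyclotomicIntegersHalf :=
  fun _ h => Algebra.subset_adjoin (Or.inl h)

theorem two_rpow_three_halves : ((2 : ℝ) ^ (3 / 2 : ℝ)) = 2 * √2 := by
  rw [show (3 / 2 : ℝ) = 1 + 1 / 2 by norm_num, Real.rpow_add two_pos, Real.rpow_one,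
    ← Real.sqrt_eq_rpow]

theorem inv_neg_four_pow_mem {R : Subalgebra ℤ ℂ} (h : (1 / 2 : ℂ) ∈ R) (l : ℕ) :
    ((-4 : ℂ) ^ l)⁻¹ ∈ R := by
  rw [← inv_pow]
  refine pow_mem ?_ l
  convert neg_mem (pow_mem h 2) using 1
  norm_num

/-- The coefficient of `q ^ (2l+1) / (1 - q ^ (2l+1))` in the entry `(i, j)` of
`A_n^+` or, up to sign, `A_n^-`. -/
noncomputable def gammaCoeff (i j l : ℕ) : ℂ :=
  alpha l * (2 ^ (3 / 2 : ℝ) : ℝ) * (eta l i * eta l j)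

theorem norm_alpha_le (l : ℕ) : ‖alpha l‖ ≤ 1 := by
  rw [alpha, norm_mul, norm_inv, norm_pow, norm_neg]
  have h : ((2 * l).choose l : ℝ) ≤ 4 ^ l := by
    exact_mod_cast (Nat.choose_le_two_pow (2 * l) l).trans (by rw [pow_mul]; norm_num)
  simp only [RCLike.norm_ofNat, RCLike.norm_natCast]
  rw [inv_mul_le_iff₀ (by positivity), mul_one]
  exact h

theorem polyGrowth_alpha : PolyGrowth alpha := .of_norm_le norm_alpha_le

theorem polyGrowth_meixner (m : ℕ) : PolyGrowth fun l => (meixner m l : ℂ) := by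
  obtain ⟨C, h⟩ := exists_meixner_le m
  refine ⟨C, m, fun l => ?_⟩
  rw [Complex.norm_real, Real.norm_of_nonneg (meixner_nonneg m l)]
  exact h l

theorem polyGrowth_const (c : ℂ) : PolyGrowth fun _ => c := .of_norm_le fun _ => le_rfl

theorem polyGrowth_eta (m : ℕ) : PolyGrowth fun l => eta l m := by
  simp only [eta_eq, Complex.ofReal_mul]
  exact (polyGrowth_const _).mul (polyGrowth_meixner m)

theorem polyGrowth_gammaCoeff (i j : ℕ) : PolyGrowth (gammaCoeff i j) :=
  (polyGrowth_alpha.mul (polyGrowth_const _)).mul ((polyGrowth_eta i).mul (polyGrowth_eta j))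

/-- In the square, one factor binom(2l,l) goes with each index: each of the two squared Meixner
values is multiplied by the central binomial coefficients of both its arguments. -/
theorem sqrt_centralBinom_mul (i j l : ℕ) :
    (l.centralBinom : ℝ) * (√(i.centralBinom : ℝ) * meixner i l) *
      (√(j.centralBinom : ℝ) * meixner j l) =
    √((meixnerNat i l * meixnerNat l i * (meixnerNat j l * meixnerNat l j) : ℕ) : ℝ) := by
  have hi := meixner_nonneg i l
  have hj := meixner_nonneg j l
  rw [← Real.sqrt_sq (show 0 ≤ (l.centralBinom : ℝ) * (√(i.centralBinom : ℝ) * meixner i l) *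
    (√(j.centralBinom : ℝ) * meixner j l) by positivity)]
  congr 1
  simp only [mul_pow]
  rw [Real.sq_sqrt (by positivity), Real.sq_sqrt (by positivity)]
  push_cast
  simp only [← centralBinom_mul_meixner, meixner_comm l]
  ring

theorem gammaCoeff_mem (i j l : ℕ) : gammaCoeff i j l ∈ cyclotomicIntegersHalf := by
  have h : gammaCoeff i j l = ((-4 : ℂ) ^ l)⁻¹ * 2 * ((√(2 : ℕ) : ℝ) : ℂ) * (1 / 2) ^ i * (1 / 2) ^ j *
      ((√((meixnerNat i l * meixnerNat l i * (meixnerNat j l * meixnerNat l j) : ℕ) : ℝ) : ℝ) : ℂ) := by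
    rw [← sqrt_centralBinom_mul, gammaCoeff, two_rpow_three_halves, alpha, eta_eq, eta_eq, orthoNorm,
      orthoNorm, ← Nat.centralBinom]
    push_cast
    simp only [one_div, inv_pow]
    ring
  rw [h]
  have h4 := inv_neg_four_pow_mem half_mem_cyclotomicIntegersHalf l
  have h5 := half_mem_cyclotomicIntegersHalf
  exact mul_mem (mul_mem (mul_mem (mul_mem (mul_mem h4 (ofNat_mem _ 2))
    (cyclotomicIntegers_le (sqrt_natCast_mem_cyclotomicIntegers _))) (pow_mem h5 _))
    (pow_mem h5 _)) (cyclotomicIntegers_le (sqrt_natCast_mem_cyclotomicIntegers _))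

theorem alpha_mul_meixner (m l : ℕ) :
    alpha l * (meixner m l : ℂ) = ((-4 : ℂ) ^ l)⁻¹ * (meixnerNat l m : ℂ) := by
  have := congrArg (fun x : ℝ => (x : ℂ)) (centralBinom_mul_meixner l m)
  rw [meixner_comm] at this
  push_cast at this
  rw [alpha, ← this, Nat.centralBinom, mul_assoc]

theorem alpha_mul_meixner_mem (i j l : ℕ) :
    alpha l * (j.centralBinom : ℂ) * (meixner i l * meixner j l : ℂ) ∈ intInvSqrtTwo := by
  have h : alpha l * (j.centralBinom : ℂ) * (meixner i l * meixner j l : ℂ) =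
      ((-4 : ℂ) ^ l)⁻¹ * (meixnerNat l i : ℂ) * (meixnerNat j l : ℂ) := by
    have := congrArg (fun x : ℝ => (x : ℂ)) (centralBinom_mul_meixner j l)
    push_cast at this
    rw [← alpha_mul_meixner, ← this]
    ring
  rw [h]
  exact mul_mem (mul_mem (inv_neg_four_pow_mem half_mem_intInvSqrtTwo l) (natCast_mem _ _))
    (natCast_mem _ _)

/-- The conjugation cancels the norm of index i and squares that of index j, so no square root other
than √2 survives. -/
theorem gammaCoeff_conj_mem (i j l : ℕ) :
    gammaCoeff i j l * ((orthoNorm i : ℂ)⁻¹ * orthoNorm j) ∈ intInvSqrtTwo := by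
  have h : gammaCoeff i j l * ((orthoNorm i : ℂ)⁻¹ * orthoNorm j) =
      2 * ((√2 : ℝ) : ℂ) * (1 / 2) ^ j * (1 / 2) ^ j *
      (alpha l * (j.centralBinom : ℂ) * (meixner i l * meixner j l : ℂ)) := by
    have h1 : (orthoNorm j : ℂ) ^ 2 = (j.centralBinom : ℂ) / 4 ^ j := by
      rw [← Complex.ofReal_pow, orthoNorm_sq]
      push_cast
      rfl
    have h2 : (orthoNorm i : ℂ) ≠ 0 := by exact_mod_cast (orthoNorm_pos i).ne'
    have h3 : (j.centralBinom : ℂ) = (orthoNorm j : ℂ) ^ 2 * 2 ^ j * 2 ^ j := by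
      rw [h1, mul_assoc, ← mul_pow]
      norm_num
    rw [gammaCoeff, two_rpow_three_halves, eta_eq, eta_eq, h3]
    push_cast
    simp only [one_div, inv_pow]
    field_simp
  rw [h]
  have h5 := half_mem_intInvSqrtTwo
  exact mul_mem (mul_mem (mul_mem (mul_mem (ofNat_mem _ 2)
    sqrt_two_mem_intInvSqrtTwo) (pow_mem h5 _)) (pow_mem h5 _)) (alpha_mul_meixner_mem i j l)

theorem star_eta (l m : ℕ) : star (eta l m) = eta l m := by
  rw [eta_eq]
  exact Complex.conj_ofReal _

theorem tsum_matrix_apply {ι : Type*} {f : ℕ → Matrix ι ι ℂ} (i j : ι)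
    (h : ∀ i j, Summable fun l => f l i j) : (∑' l, f l) i j = ∑' l, f l i j := by
  have h1 : Summable f := Pi.summable.mpr fun i => Pi.summable.mpr fun j => h i j
  exact ((Pi.hasSum.mp ((Pi.hasSum.mp h1.hasSum) i)) j).tsum_eq.symm

theorem APlus_apply (n : ℕ) {q : ℂ} (hq : ‖q‖ < 1) (i j : EvenIdx n) :
    APlus n q i j = ∑' l, gammaCoeff (i : Fin (n + 1)) (j : Fin (n + 1)) l *
      (q ^ (2 * l + 1) / (1 - q ^ (2 * l + 1))) := by
  have e : ∀ (i j : EvenIdx n) (l : ℕ),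
      ((alpha l * (q ^ (2 * l + 1) / (1 - q ^ (2 * l + 1)))) • TPlus n l) i j =
      gammaCoeff (i : Fin (n + 1)) (j : Fin (n + 1)) l *
        (q ^ (2 * l + 1) / (1 - q ^ (2 * l + 1))) := by
    intro i j l
    simp only [TPlus, Matrix.smul_apply, Matrix.vecMulVec_apply, etaPlus, Pi.star_apply, star_eta,
      smul_eq_mul, gammaCoeff]
    ring
  rw [APlus, tsum_matrix_apply]
  · simp only [e]
  · intro i j
    simp only [e]
    exact ((polyGrowth_gammaCoeff _ _).hasSum_lambert hq).summable

theorem AMinus_apply (n : ℕ) {q : ℂ} (hq : ‖q‖ < 1) (i j : OddIdx n) :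
    AMinus n q i j = ∑' l, -gammaCoeff (i : Fin (n + 1)) (j : Fin (n + 1)) l *
      (q ^ (2 * l + 1) / (1 - q ^ (2 * l + 1))) := by
  have e : ∀ (i j : OddIdx n) (l : ℕ),
      ((alpha l * (q ^ (2 * l + 1) / (1 - q ^ (2 * l + 1)))) • TMinus n l) i j =
      -(gammaCoeff (i : Fin (n + 1)) (j : Fin (n + 1)) l *
        (q ^ (2 * l + 1) / (1 - q ^ (2 * l + 1)))) := by
    intro i j l
    simp only [TMinus, Matrix.smul_apply, Matrix.vecMulVec_apply, etaMinus, Pi.star_apply, star_eta,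
      smul_eq_mul, gammaCoeff]
    ring
  rw [AMinus, tsum_matrix_apply]
  · simp only [e, neg_mul]
  · intro i j
    simp only [e]
    exact ((polyGrowth_gammaCoeff _ _).hasSum_lambert hq).summable.neg

theorem hasQExpansionIn_gammaMatrix (n : ℕ) (i j : Fin (n + 1)) :
    HasQExpansionIn cyclotomicIntegersHalf (fun q => gammaMatrix n q i j) := by
  have h := (polyGrowth_gammaCoeff i j).hasQExpansionIn_lambert (gammaCoeff_mem i j)
  by_cases hi : Even (i : ℕ) <;> by_cases hj : Even (j : ℕ)
  · refine h.congr fun q hq => ?_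
    simp [gammaMatrix, hi, hj, APlus_apply n hq]
  · refine (HasQExpansionIn.const (zero_mem _)).congr fun q hq => ?_
    simp [gammaMatrix, hi, hj]
  · refine (HasQExpansionIn.const (zero_mem _)).congr fun q hq => ?_
    simp [gammaMatrix, hi, hj]
  · refine h.neg.congr fun q hq => ?_
    simp [gammaMatrix, hi, hj, AMinus_apply n hq, tsum_neg]

theorem hasQExpansionIn_traceWedge_of_lambert {ι : Type} [Fintype ι] [LinearOrder ι] (m : ℕ)
    {A : ℂ → Matrix ι ι ℂ} (e : ι → ℕ) (c : ι → ι → ℕ → ℂ)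
    (hc : ∀ i j, PolyGrowth (c i j))
    (hR : ∀ i j l, c i j l * ((orthoNorm (e i) : ℂ)⁻¹ * orthoNorm (e j)) ∈ intInvSqrtTwo)
    (hA : ∀ q : ℂ, ‖q‖ < 1 → ∀ i j, A q i j =
      ∑' l, c i j l * (q ^ (2 * l + 1) / (1 - q ^ (2 * l + 1)))) :
    HasQExpansionIn intInvSqrtTwo (fun q => traceWedge m (A q)) := by
  let B : ℂ → Matrix ι ι ℂ := fun q => Matrix.of fun i j =>
    ∑' l, c i j l * ((orthoNorm (e i) : ℂ)⁻¹ * orthoNorm (e j)) *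
      (q ^ (2 * l + 1) / (1 - q ^ (2 * l + 1)))
  have hB : HasQExpansionIn intInvSqrtTwo (fun q => traceWedge m (B q)) :=
    HasQExpansionIn.traceWedge m fun i j =>
      ((hc i j).mul (polyGrowth_const _)).hasQExpansionIn_lambert (hR i j)
  refine hB.congr fun q hq => ?_
  refine traceWedge_diag_conj m _ _ (fun i => (orthoNorm (e i) : ℂ))
    (fun i => by exact_mod_cast (orthoNorm_pos (e i)).ne') fun i j => ?_
  rw [hA q hq, ← tsum_mul_left, ← tsum_mul_right]
  exact tsum_congr fun l => by ring

theorem hasQExpansionIn_traceWedge_APlus (n m : ℕ) :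
    HasQExpansionIn intInvSqrtTwo (fun q => traceWedge m (APlus n q)) := by
  convert hasQExpansionIn_traceWedge_of_lambert (ι := EvenIdx n) m (A := APlus n)
    (fun i => (i : Fin (n + 1))) (fun i j => gammaCoeff (i : Fin (n + 1)) (j : Fin (n + 1)))
    (fun i j => polyGrowth_gammaCoeff _ _) (fun i j l => gammaCoeff_conj_mem _ _ l)
    (fun q hq i j => APlus_apply n hq i j)

theorem hasQExpansionIn_traceWedge_AMinus (n m : ℕ) :
    HasQExpansionIn intInvSqrtTwo (fun q => traceWedge m (AMinus n q)) := by
  convert hasQExpansionIn_traceWedge_of_lambert (ι := OddIdx n) m (A := AMinus n)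
    (fun i => (i : Fin (n + 1))) (fun i j l => -gammaCoeff (i : Fin (n + 1)) (j : Fin (n + 1)) l)
    (fun i j => by simpa [PolyGrowth] using polyGrowth_gammaCoeff _ _)
    (fun i j l => by rw [neg_mul]; exact neg_mem (gammaCoeff_conj_mem _ _ l))
    (fun q hq i j => AMinus_apply n hq i j)

section

open Polynomial

/-! ### Derivatives of the archimedean generating function -/

/-- The polynomials `R_k` with `archGen^{(k)}(x) = archGen x * R_k (tanh x)`. -/
noncomputable def archPoly : ℕ → ℝ[X]
  | 0 => 1
  | k + 1 => (1 - X ^ 2) * derivative (archPoly k) - C (1 / 2) * X * archPoly k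

theorem hasDerivAt_tanh (x : ℝ) : HasDerivAt Real.tanh (1 - Real.tanh x ^ 2) x := by
  have h := (Real.hasDerivAt_sinh x).div (Real.hasDerivAt_cosh x) (Real.cosh_pos x).ne'
  have e : Real.tanh = fun x => Real.sinh x / Real.cosh x := by
    ext y
    exact Real.tanh_eq_sinh_div_cosh y
  rw [e]
  refine h.congr_deriv ?_
  have := (Real.cosh_pos x).ne'
  rw [← e, Real.tanh_eq_sinh_div_cosh]
  field_simp

theorem archGen_eq (x : ℝ) : archGen x = (2 * Real.cosh x) ^ (-1 / 2 : ℝ) := by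
  have h : Real.exp (-x) + Real.exp x = 2 * Real.cosh x := by rw [Real.cosh_eq]; ring
  have := Real.cosh_pos x
  rw [archGen, h, Real.sqrt_eq_rpow, one_div, ← Real.rpow_neg (by positivity)]
  norm_num

theorem hasDerivAt_archGen (x : ℝ) :
    HasDerivAt archGen (-(1 / 2) * Real.tanh x * archGen x) x := by
  have hc := Real.cosh_pos x
  have h := ((Real.hasDerivAt_cosh x).const_mul 2).rpow_const (p := (-1 / 2 : ℝ))
    (Or.inl (by positivity))
  rw [show archGen = _ from funext archGen_eq]
  convert h using 1
  rw [Real.rpow_sub_one (by positivity), Real.tanh_eq_sinh_div_cosh]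
  field_simp

theorem iteratedDeriv_archGen (k : ℕ) :
    iteratedDeriv k archGen = fun x => archGen x * (archPoly k).eval (Real.tanh x) := by
  induction k with
  | zero => simp [archPoly]
  | succ k ih =>
    rw [iteratedDeriv_succ, ih]
    ext x
    have h := (hasDerivAt_archGen x).mul
      (((archPoly k).hasDerivAt (Real.tanh x)).comp x (hasDerivAt_tanh x))
    refine h.deriv.trans ?_
    simp only [archPoly, eval_sub, eval_mul, eval_one, eval_pow, eval_X, eval_C, Function.comp]
    ring

theorem archGen_zero : archGen 0 = 1 / √2 := by
  norm_num [archGen]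

theorem archGen_neg (x : ℝ) : archGen (-x) = archGen x := by
  rw [archGen, archGen, neg_neg, add_comm]

theorem contDiff_archGen {n : WithTop ℕ∞} : ContDiff ℝ n archGen := by
  rw [show archGen = _ from funext archGen_eq]
  refine ContDiff.rpow_const_of_ne (by fun_prop) fun x => ?_
  have := Real.cosh_pos x
  positivity

/-- The sequence of moments with vanishing odd terms and prescribed even terms. -/
noncomputable def fullMoment (e : ℕ → ℝ) (k : ℕ) : ℂ :=
  if Even k then (e (k / 2) : ℂ) else 0

/-- The sign (-1)^k of the even moments is i^{2k}, and the odd derivatives of an even function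
vanish at 0. -/
theorem fullMoment_arch (k : ℕ) :
    fullMoment archEvenMoment k = Complex.I ^ k * ((iteratedDeriv k archGen 0 : ℝ) : ℂ) := by
  rw [fullMoment]
  split_ifs with h
  · obtain ⟨m, rfl⟩ := h
    rw [← two_mul, Nat.mul_div_cancel_left m two_pos, archEvenMoment, pow_mul, Complex.I_sq]
    push_cast
    rfl
  · have h1 : iteratedDeriv k archGen 0 = 0 := by
      have h2 := iteratedDeriv_comp_neg k archGen 0
      simp only [archGen_neg, neg_zero, (Nat.not_even_iff_odd.mp h).neg_one_pow] at h2
      rw [neg_one_smul] at h2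
      linarith
    rw [h1]
    simp

/-! ### Moment functionals -/

/-- The linear functional on polynomials with given moments. -/
noncomputable def momentFunctional (c : ℕ → ℂ) : ℂ[X] →ₗ[ℂ] ℂ :=
  Polynomial.lsum fun k => LinearMap.toSpanSingleton ℂ ℂ (c k)

theorem momentFunctional_monomial (c : ℕ → ℂ) (k : ℕ) (a : ℂ) :
    momentFunctional c (monomial k a) = a * c k := by
  simp [momentFunctional, Polynomial.lsum_apply, Polynomial.sum_monomial_index]

theorem momentFunctional_mul (c : ℕ → ℂ) {P Q : ℂ[X]} {n : ℕ} (hP : P.natDegree < n)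
    (hQ : Q.natDegree < n) :
    momentFunctional c (P * Q) = ∑ a : Fin n, ∑ b : Fin n,
      P.coeff a * c (a + b) * Q.coeff b := by
  conv_lhs => rw [P.as_sum_range' n hP, Q.as_sum_range' n hQ]
  rw [Finset.sum_mul_sum, map_sum, Finset.sum_range]
  refine Finset.sum_congr rfl fun a _ => ?_
  rw [map_sum, Finset.sum_range]
  refine Finset.sum_congr rfl fun b _ => ?_
  rw [monomial_mul_monomial, momentFunctional_monomial]
  ring

/-- The matrix of coefficients of a family of polynomials. -/
noncomputable def coeffMatrix (n : ℕ) (P : ℕ → ℂ[X]) : Matrix (Fin (n + 1)) (Fin (n + 1)) ℂ :=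
  Matrix.of fun i a => (P i).coeff a

theorem coeffMatrix_mul_evenHankel (e : ℕ → ℝ) (n : ℕ) (P : ℕ → ℂ[X])
    (hP : ∀ m, (P m).natDegree ≤ m) :
    coeffMatrix n P * (evenHankel e n).map (algebraMap ℝ ℂ) * (coeffMatrix n P).transpose =
      Matrix.of fun i j : Fin (n + 1) => momentFunctional (fullMoment e) (P i * P j) := by
  ext i j
  rw [Matrix.of_apply, momentFunctional_mul _ ((hP i).trans_lt i.2) ((hP j).trans_lt j.2),
    Matrix.mul_apply, Finset.sum_comm]
  refine Finset.sum_congr rfl fun b _ => ?_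
  rw [Matrix.mul_apply, Finset.sum_mul]
  refine Finset.sum_congr rfl fun a _ => ?_
  simp only [coeffMatrix, Matrix.of_apply, Matrix.map_apply, Matrix.transpose_apply, evenHankel,
    fullMoment]
  congr 2
  split_ifs <;> simp

/-- A change of basis multiplies the Gram determinant by a square. The pairing is bilinear, without
conjugation. -/
theorem det_coeffMatrix_mul_evenHankel (e : ℕ → ℝ) (n : ℕ) (P : ℕ → ℂ[X])
    (hP : ∀ m, (P m).natDegree ≤ m) :
    (coeffMatrix n P).det ^ 2 * ((evenHankel e n).det : ℂ) =
      (Matrix.of fun i j : Fin (n + 1) => momentFunctional (fullMoment e) (P i * P j)).det := by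
  rw [← coeffMatrix_mul_evenHankel e n P hP, Matrix.det_mul, Matrix.det_mul, Matrix.det_transpose]
  have : ((evenHankel e n).map (algebraMap ℝ ℂ)).det = ((evenHankel e n).det : ℂ) :=
    (RingHom.map_det (algebraMap ℝ ℂ) _).symm
  rw [this]
  ring

/-! ### Orthogonality -/

/-- The operator `R ↦ (1 - y²) R' - y R / 2`, which is the derivation by `x` on functions
`archGen x * R (tanh x)`. -/
noncomputable def archDeriv : ℂ[X] →ₗ[ℂ] ℂ[X] :=
  LinearMap.mulLeft ℂ (1 - X ^ 2) ∘ₗ derivative - LinearMap.mulLeft ℂ (C (1 / 2) * X)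

theorem archDeriv_apply (R : ℂ[X]) :
    archDeriv R = (1 - X ^ 2) * derivative R - C (1 / 2) * X * R := rfl

theorem archDeriv_pow_one (k : ℕ) : (archDeriv ^ k) 1 = (archPoly k).map (algebraMap ℝ ℂ) := by
  induction k with
  | zero => simp [archPoly]
  | succ k ih =>
    rw [pow_succ', Module.End.mul_apply, ih, archDeriv_apply, archPoly]
    simp [derivative_map]

/-- The polynomial `P(i∂) archGen / archGen` in `tanh`. -/
noncomputable def archSymbol : ℂ[X] →ₗ[ℂ] ℂ[X] :=
  LinearMap.applyₗ 1 ∘ₗ (aeval (Complex.I • archDeriv)).toLinearMap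

theorem archSymbol_apply (P : ℂ[X]) : archSymbol P = aeval (Complex.I • archDeriv) P 1 := rfl

theorem archSymbol_X_mul (P : ℂ[X]) :
    archSymbol (X * P) = C Complex.I * archDeriv (archSymbol P) := by
  rw [archSymbol_apply, map_mul, aeval_X, Module.End.mul_apply, LinearMap.smul_apply,
    smul_eq_C_mul]
  rfl

theorem archSymbol_one : archSymbol 1 = 1 := by
  simp [archSymbol_apply]

theorem archSymbol_C_mul (a : ℂ) (P : ℂ[X]) : archSymbol (C a * P) = C a * archSymbol P := by
  rw [← smul_eq_C_mul, map_smul, smul_eq_C_mul]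

/-- The functional is P(i∂)`archGen` at 0, where tanh vanishes and `archGen` equals 1/√2. -/
theorem momentFunctional_arch (P : ℂ[X]) :
    momentFunctional (fullMoment archEvenMoment) P =
      ((1 / √2 : ℝ) : ℂ) * (archSymbol P).eval 0 := by
  induction P using Polynomial.induction_on' with
  | add P Q hP hQ => rw [map_add, map_add, hP, hQ, eval_add]; ring
  | monomial k a =>
    rw [momentFunctional_monomial, fullMoment_arch, iteratedDeriv_archGen, ← C_mul_X_pow_eq_monomial,
      archSymbol_C_mul, archSymbol_apply, map_pow, aeval_X, _root_.smul_pow, LinearMap.smul_apply,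
      archDeriv_pow_one, eval_mul, eval_C, eval_smul]
    have : ((archPoly k).map (algebraMap ℝ ℂ)).eval 0 = (((archPoly k).eval 0 : ℝ) : ℂ) := by
      have := Polynomial.eval_map_algebraMap (B := ℂ) (archPoly k) 0
      rw [this]
      simpa using (Polynomial.aeval_algebraMap_apply ℂ (0 : ℝ) (archPoly k))
    rw [this]
    simp only [archGen_zero, Real.tanh_zero, smul_eq_mul]
    push_cast
    ring

theorem archDeriv_X_pow_succ (m : ℕ) :
    archDeriv (X ^ (m + 1)) = C ((m : ℂ) + 1) * X ^ m - C ((m : ℂ) + 3 / 2) * X ^ (m + 2) := by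
  rw [archDeriv_apply, derivative_X_pow]
  have : (C ((m : ℂ) + 3 / 2) : ℂ[X]) = C ((m : ℂ) + 1) + C (1 / 2) := by
    rw [← C_add]; congr 1; ring
  rw [this]
  push_cast
  ring

theorem natCast_add_half_ne_zero (m : ℕ) : (m : ℂ) + 3 / 2 ≠ 0 := by
  have : (2 * m + 3 : ℂ) ≠ 0 := by exact_mod_cast (2 * m + 2).succ_ne_zero
  intro h
  apply this
  linear_combination 2 * h

/-- Multiplication by iX becomes -`archDeriv`, which sends X^{m+1} to (m+3/2)X^{m+2} - (m+1)X^m: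
exactly the recurrence of `meixnerPoly`. -/
theorem archSymbol_meixnerPoly (m : ℕ) : archSymbol (meixnerPoly m) = X ^ m := by
  have hI : (C Complex.I * C Complex.I : ℂ[X]) = -1 := by
    rw [← C_mul, Complex.I_mul_I, C_neg, C_1]
  induction m using Nat.twoStepInduction with
  | zero => rw [meixnerPoly_zero, archSymbol_one, pow_zero]
  | one =>
    refine mul_left_cancel₀ (C_ne_zero.mpr (one_div_ne_zero (two_ne_zero' ℂ))) ?_
    rw [← archSymbol_C_mul, meixnerPoly_one, archSymbol_C_mul, ← mul_one X, archSymbol_X_mul,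
      archSymbol_one, archDeriv_apply, derivative_one, ← mul_assoc, hI]
    ring
  | more m ih1 ih2 =>
    refine mul_left_cancel₀ (C_ne_zero.mpr (natCast_add_half_ne_zero m)) ?_
    rw [← archSymbol_C_mul, meixnerPoly_recurrence, map_add, archSymbol_C_mul, mul_assoc,
      archSymbol_C_mul, archSymbol_X_mul, ih1, ih2, archDeriv_X_pow_succ, ← mul_assoc, hI]
    ring

theorem momentFunctional_arch_meixnerPoly (m : ℕ) :
    momentFunctional (fullMoment archEvenMoment) (meixnerPoly m) =
      if m = 0 then ((1 / √2 : ℝ) : ℂ) else 0 := by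
  rw [momentFunctional_arch, archSymbol_meixnerPoly, eval_pow, eval_X, zero_pow_eq]
  simp

/-- The squared norms of the polynomials `meixnerPoly`. -/
noncomputable def meixnerNorm (m : ℕ) : ℂ := (-4) ^ m / (m.centralBinom : ℂ)

theorem meixnerNorm_succ (m : ℕ) :
    ((m : ℂ) + 1 / 2) * meixnerNorm (m + 1) = -((m : ℂ) + 1) * meixnerNorm m := by
  have h1 : ((m : ℂ) + 1) * (m + 1).centralBinom = 2 * (2 * m + 1) * m.centralBinom := by
    exact_mod_cast Nat.succ_mul_centralBinom_succ m
  have n1 : ((m + 1).centralBinom : ℂ) ≠ 0 := by exact_mod_cast (m + 1).centralBinom_ne_zero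
  have n2 : (m.centralBinom : ℂ) ≠ 0 := by exact_mod_cast m.centralBinom_ne_zero
  rw [meixnerNorm, meixnerNorm]
  field_simp
  linear_combination 2 * (-4) ^ m * h1

theorem momentFunctional_arch_mul (m n : ℕ) :
    momentFunctional (fullMoment archEvenMoment) (meixnerPoly m * meixnerPoly n) =
      if m = n then ((1 / √2 : ℝ) : ℂ) * meixnerNorm m else 0 := by
  set L := momentFunctional (fullMoment archEvenMoment)
  have hC : ∀ (a : ℂ) (P : ℂ[X]), L (C a * P) = a * L P := fun a P => by
    rw [← smul_eq_C_mul, map_smul, smul_eq_mul]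
  have hrec : ∀ k : ℕ, C Complex.I * X * meixnerPoly k =
      C ((k : ℂ) + 1 / 2) * meixnerPoly (k + 1) - C (k : ℂ) * meixnerPoly (k - 1) := by
    intro k
    cases k with
    | zero => simp [meixnerPoly_zero, ← meixnerPoly_one]
    | succ k =>
      have h := meixnerPoly_recurrence k
      rw [show ((k + 1 : ℕ) : ℂ) + 1 / 2 = k + 3 / 2 by push_cast; ring, h]
      simp
  -- Both sides come from expanding iX times the product, with the recurrence applied to either
  -- factor; this lowers the second index.
  have step : ∀ m n : ℕ, ((n : ℂ) + 1 / 2) * L (meixnerPoly m * meixnerPoly (n + 1)) =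
      ((m : ℂ) + 1 / 2) * L (meixnerPoly (m + 1) * meixnerPoly n) -
        m * L (meixnerPoly (m - 1) * meixnerPoly n) +
        n * L (meixnerPoly m * meixnerPoly (n - 1)) := by
    intro m n
    have e : C ((n : ℂ) + 1 / 2) * (meixnerPoly m * meixnerPoly (n + 1)) =
        C ((m : ℂ) + 1 / 2) * (meixnerPoly (m + 1) * meixnerPoly n) -
        C (m : ℂ) * (meixnerPoly (m - 1) * meixnerPoly n) +
        C (n : ℂ) * (meixnerPoly m * meixnerPoly (n - 1)) := by
      linear_combination meixnerPoly n * hrec m - meixnerPoly m * hrec n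
    have := congrArg L e
    rwa [hC, map_add L, map_sub L, hC, hC, hC] at this
  have half : ∀ k : ℕ, (k : ℂ) + 1 / 2 ≠ 0 := fun k h => by
    have : (2 * k + 1 : ℂ) ≠ 0 := by exact_mod_cast (2 * k).succ_ne_zero
    exact this (by linear_combination 2 * h)
  induction n using Nat.strong_induction_on generalizing m with
  | _ n ih =>
    cases n with
    | zero =>
      rw [meixnerPoly_zero, mul_one, momentFunctional_arch_meixnerPoly]
      split_ifs with h
      · subst h; simp [meixnerNorm]
      · rfl
    | succ n =>
      refine mul_left_cancel₀ (half n) ?_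
      rw [step, ih n (by omega), ih n (by omega), ih (n - 1) (by omega)]
      set a := ((1 / √2 : ℝ) : ℂ)
      rcases lt_trichotomy m (n + 1) with h | rfl | h
      -- For m ≤ n, the truncated equality m - 1 = n is possible only for m = 0, where the
      -- coefficient m vanishes.
      · have h0 : (m : ℂ) * (if m - 1 = n then a * meixnerNorm (m - 1) else 0) = 0 := by
          split_ifs with h3
          · rw [show m = 0 by omega]
            simp
          · exact mul_zero _
        rw [h0, if_neg h.ne]
        by_cases h1 : m + 1 = n
        · subst h1
          simp only [Nat.add_sub_cancel, if_true]
          have := meixnerNorm_succ m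
          push_cast
          linear_combination a * this
        · have h2 : (n : ℂ) * (if m = n - 1 then a * meixnerNorm m else 0) = 0 := by
            split_ifs with h3
            · rw [show n = 0 by omega]
              simp
            · exact mul_zero _
          rw [if_neg h1, h2]
          ring
      · rw [if_neg (show n + 1 + 1 ≠ n by omega), if_neg (show n + 1 ≠ n - 1 by omega)]
        simp only [Nat.add_sub_cancel, if_true]
        have := meixnerNorm_succ n
        push_cast
        linear_combination -a * this
      · rw [if_neg (show m + 1 ≠ n by omega), if_neg (show m - 1 ≠ n by omega),
          if_neg (show m ≠ n - 1 by omega), if_neg h.ne']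
        ring

end

/-! ### The contribution of the finite place -/

theorem choose_neg_half (l : ℕ) :
    Ring.choose (-1 / 2 : ℝ) l = ((-4 : ℝ) ^ l)⁻¹ * (l.centralBinom : ℝ) := by
  have h : ∀ l : ℕ, (descPochhammer ℤ l).smeval (-1 / 2 : ℝ) =
      (l.factorial : ℝ) * (((-4 : ℝ) ^ l)⁻¹ * (l.centralBinom : ℝ)) := by
    intro l
    induction l with
    | zero => simp
    | succ l ih =>
      have h1 : ((l : ℝ) + 1) * (l + 1).centralBinom = 2 * (2 * l + 1) * l.centralBinom := by
        exact_mod_cast Nat.succ_mul_centralBinom_succ l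
      rw [descPochhammer_succ_right, Polynomial.smeval_mul, ih, Polynomial.smeval_sub,
        Polynomial.smeval_X, Polynomial.smeval_natCast, Nat.factorial_succ, pow_succ (-4 : ℝ),
        mul_inv]
      push_cast
      rw [pow_one, pow_zero, nsmul_eq_mul, mul_one]
      linear_combination ((1 / 4) * (l.factorial : ℝ) * ((-4 : ℝ) ^ l)⁻¹) * h1
  rw [Ring.choose_eq_smul, h, smul_eq_mul, ← mul_assoc,
    inv_mul_cancel₀ (by exact_mod_cast l.factorial_ne_zero), one_mul]

theorem hasSum_one_add_rpow_neg_half {u : ℝ} (hu : |u| < 1) :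
    HasSum (fun l : ℕ => ((-4 : ℝ) ^ l)⁻¹ * (l.centralBinom : ℝ) * u ^ l)
      ((1 + u) ^ (-1 / 2 : ℝ)) := by
  have h := (Real.one_add_rpow_hasFPowerSeriesOnBall_zero (a := -1 / 2)).hasSum (y := u)
    (by simpa [enorm_eq_nnnorm, ← NNReal.coe_lt_coe] using hu)
  simp only [binomialSeries_apply, choose_neg_half, zero_add, List.ofFn_const, List.prod_replicate,
    smul_eq_mul] at h
  exact h

theorem hasSum_const_mul_exp (a x : ℝ) :
    HasSum (fun k : ℕ => a * (x ^ k / (k.factorial : ℝ))) (a * Real.exp x) := by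
  rw [Real.exp_eq_exp_ℝ]
  exact (NormedSpace.expSeries_div_hasSum_exp x).mul_left a

theorem hasSum_of_eq {ι α : Type*} [AddCommMonoid α] [TopologicalSpace α] {f g : ι → α} {a : α}
    (h : HasSum f a) (e : ∀ i, g i = f i) : HasSum g a :=
  (funext e : g = f) ▸ h

theorem summable_prod_of_hasSum {f : ℕ × ℕ → ℝ} {g : ℕ → ℝ} (h0 : ∀ y, 0 ≤ f y)
    (hf : ∀ l, HasSum (fun n => f (l, n)) (g l)) (hg : Summable g) : Summable f :=
  (summable_prod_of_nonneg h0).mpr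
    ⟨fun l => (hf l).summable, hg.congr fun l => ((hf l).tsum_eq).symm⟩

theorem summable_prod_exp {β μ : ℕ → ℝ} {r : ℝ} (hr : 0 ≤ r)
    (h : Summable fun l => |β l| * Real.exp (|μ l| * r)) :
    Summable fun x : ℕ × ℕ => |β x.1| * ((|μ x.1| * r) ^ x.2 / (x.2.factorial : ℝ)) := by
  refine summable_prod_of_hasSum (fun y => ?_)
    (fun l => hasSum_const_mul_exp (|β l|) (|μ l| * r)) h
  positivity

/-- Expanding the exponentials gives a summable double family; its part of degree k is, up to a
constant, the series in question. -/
theorem summable_mul_pow_of_exp {β μ : ℕ → ℝ} {r : ℝ} (hr : 0 < r)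
    (h : Summable fun l => |β l| * Real.exp (|μ l| * r)) (k : ℕ) :
    Summable fun l => |β l * μ l ^ k| := by
  have hk0 : (k.factorial : ℝ) ≠ 0 := by exact_mod_cast k.factorial_ne_zero
  have h1 := (summable_prod_exp hr.le h).prod_symm.prod_factor k
  refine (h1.mul_right (k.factorial / r ^ k)).congr fun l => ?_
  simp only [Prod.swap]
  rw [abs_mul, abs_pow, mul_pow]
  field_simp

theorem hasSum_tsum_exp {β μ : ℕ → ℝ} {r x : ℝ} (hx : |x| < r)
    (h : Summable fun l => |β l| * Real.exp (|μ l| * r)) :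
    HasSum (fun k => (∑' l, β l * μ l ^ k) / (k.factorial : ℝ) * x ^ k)
      (∑' l, β l * Real.exp (μ l * x)) := by
  have hr : 0 < r := (abs_nonneg x).trans_lt hx
  have hk := summable_mul_pow_of_exp hr h
  have hS2 : Summable fun y : ℕ × ℕ => β y.1 * ((μ y.1 * x) ^ y.2 / (y.2.factorial : ℝ)) := by
    refine Summable.of_norm_bounded (summable_prod_exp hr.le h) fun y => ?_
    rw [Real.norm_eq_abs, abs_mul, abs_div, Nat.abs_cast, abs_pow, abs_mul]
    have h1 : |μ y.1| * |x| ≤ |μ y.1| * r := mul_le_mul_of_nonneg_left hx.le (abs_nonneg (μ y.1))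
    have h2 : (|μ y.1| * |x|) ^ y.2 ≤ (|μ y.1| * r) ^ y.2 :=
      pow_le_pow_left₀ (by positivity) h1 _
    exact mul_le_mul_of_nonneg_left (div_le_div_of_nonneg_right h2 (Nat.cast_nonneg _))
      (abs_nonneg _)
  have h1 := hS2.hasSum.prod_fiberwise fun l => hasSum_const_mul_exp (β l) (μ l * x)
  rw [h1.tsum_eq]
  refine ((Equiv.prodComm ℕ ℕ).hasSum_iff.mpr hS2.hasSum).prod_fiberwise fun k => ?_
  have h3 := (hk k).of_abs.hasSum.mul_right (x ^ k / (k.factorial : ℝ))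
  rw [div_mul_eq_mul_div, mul_div_assoc]
  refine hasSum_of_eq h3 fun l => ?_
  simp only [Function.comp, Equiv.prodComm_apply, Prod.swap]
  rw [mul_pow]
  ring

/-- Power series expansion of a sum of exponentials. -/
theorem hasFPowerSeriesOnBall_tsum_exp {β μ : ℕ → ℝ} {r : NNReal} (hr : 0 < r)
    (h : Summable fun l => |β l| * Real.exp (|μ l| * r)) :
    HasFPowerSeriesOnBall (fun x => ∑' l, β l * Real.exp (μ l * x))
      (FormalMultilinearSeries.ofScalars ℝ
        fun k => (∑' l, β l * μ l ^ k) / (k.factorial : ℝ)) 0 r := by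
  have hk := summable_mul_pow_of_exp hr h
  have hS := summable_prod_exp r.2 h
  have habs : ∀ k, |∑' l, β l * μ l ^ k| ≤ ∑' l, |β l * μ l ^ k| := by
    intro k
    have h1 : Summable fun l => ‖β l * μ l ^ k‖ := hk k
    have h2 := norm_tsum_le_tsum_norm h1
    simpa only [Real.norm_eq_abs] using h2
  refine ⟨?_, by exact_mod_cast hr, fun {x} hx => ?_⟩
  · refine FormalMultilinearSeries.le_radius_of_summable _ ?_
    refine Summable.of_nonneg_of_le (fun k => by positivity) (fun k => ?_) hS.prod_symm.prod
    have hk0 : (k.factorial : ℝ) ≠ 0 := by exact_mod_cast k.factorial_ne_zero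
    have e : ∀ l, |β l| * ((|μ l| * r) ^ k / (k.factorial : ℝ)) =
        |β l * μ l ^ k| * (r ^ k / (k.factorial : ℝ)) := by
      intro l
      rw [abs_mul, abs_pow, mul_pow]
      ring
    change _ ≤ ∑' l, |β l| * ((|μ l| * r) ^ k / (k.factorial : ℝ))
    simp only [e]
    rw [FormalMultilinearSeries.ofScalars_norm, Real.norm_eq_abs, abs_div, Nat.abs_cast,
      div_mul_eq_mul_div, mul_div_assoc, tsum_mul_right]
    gcongr
    exact habs k
  · rw [zero_add]
    refine hasSum_of_eq (hasSum_tsum_exp ?_ h) fun k => ?_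
    · simpa [enorm_eq_nnnorm, ← NNReal.coe_lt_coe] using hx
    · rw [FormalMultilinearSeries.ofScalars_apply_eq, smul_eq_mul]

theorem iteratedDeriv_tsum_exp {β μ : ℕ → ℝ} {r : NNReal} (hr : 0 < r)
    (h : Summable fun l => |β l| * Real.exp (|μ l| * r)) (k : ℕ) :
    iteratedDeriv k (fun x => ∑' l, β l * Real.exp (μ l * x)) 0 = ∑' l, β l * μ l ^ k := by
  have h1 := (hasFPowerSeriesOnBall_tsum_exp hr h).factorial_smul 1 k
  rw [iteratedDeriv_eq_iteratedFDeriv, ← h1, FormalMultilinearSeries.ofScalars_apply_eq]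
  have hk0 : (k.factorial : ℝ) ≠ 0 := by exact_mod_cast k.factorial_ne_zero
  simp only [smul_eq_mul, nsmul_eq_mul, one_pow, mul_one]
  field_simp

/-- The coefficient of the exponential `e^{-(1/2+2l)x}` in `primeGen p x`. -/
noncomputable def primeCoeff (q : ℝ) (l : ℕ) : ℝ :=
  ((-4 : ℝ) ^ l)⁻¹ * (l.centralBinom : ℝ) * (q ^ (2 * l + 1) / (1 - q ^ (2 * l + 1)))

theorem ofReal_alpha (l : ℕ) :
    ((((-4 : ℝ) ^ l)⁻¹ * (l.centralBinom : ℝ) : ℝ) : ℂ) = alpha l := by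
  rw [alpha, Nat.centralBinom]
  push_cast
  rfl

theorem abs_alpha_le (l : ℕ) : |((-4 : ℝ) ^ l)⁻¹ * (l.centralBinom : ℝ)| ≤ 1 := by
  have := norm_alpha_le l
  rwa [← ofReal_alpha, Complex.norm_real] at this

/-- The radicand is (p^{n+1} e^{x/2})² (1 + w²) with w = p^{-(n+1)} e^{-x}. The bound on x gives w <
1, and the binomial series applies. -/
theorem hasSum_primeGen_term {p x : ℝ} (hp : 1 < p) (hx : |x| < Real.log p) (n : ℕ) :
    HasSum (fun l : ℕ => ((-4 : ℝ) ^ l)⁻¹ * (l.centralBinom : ℝ) *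
        ((1 / p) ^ ((2 * l + 1) * (n + 1)) * Real.exp (-(1 / 2 + 2 * l) * x)))
      (1 / √(p ^ (2 * (n + 1)) * Real.exp x + Real.exp (-x))) := by
  have hp0 : 0 < p := by linarith
  set w := (1 / p) ^ (n + 1) * Real.exp (-x) with hw
  have hw0 : 0 < w := by positivity
  have hw1 : w < 1 := by
    have h1 : Real.exp (-x) < p := by
      rw [← Real.lt_log_iff_exp_lt hp0]
      exact (neg_le_abs x).trans_lt hx
    have h2 : (1 / p) ^ (n + 1) ≤ 1 / p := by
      refine pow_le_of_le_one (by positivity) ?_ (by omega)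
      rw [div_le_one hp0]
      exact hp.le
    calc w ≤ 1 / p * Real.exp (-x) := mul_le_mul_of_nonneg_right h2 (Real.exp_pos _).le
      _ < 1 / p * p := mul_lt_mul_of_pos_left h1 (by positivity)
      _ = 1 := by field_simp
  have h := (hasSum_one_add_rpow_neg_half (u := w ^ 2)
    (by rw [abs_of_pos (by positivity)]; nlinarith)).mul_left
      ((1 / p) ^ (n + 1) * Real.exp (-(1 / 2) * x))
  have e1 : (1 / p) ^ (n + 1) * Real.exp (-(1 / 2) * x) * (1 + w ^ 2) ^ (-1 / 2 : ℝ) =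
      1 / √(p ^ (2 * (n + 1)) * Real.exp x + Real.exp (-x)) := by
    have e2 : p ^ (2 * (n + 1)) * Real.exp x + Real.exp (-x) =
        (p ^ (n + 1) * Real.exp ((1 / 2) * x)) ^ 2 * (1 + w ^ 2) := by
      have h3 : Real.exp ((1 / 2) * x) ^ 2 = Real.exp x := by
        rw [← Real.exp_nat_mul]
        congr 1
        push_cast
        ring
      have h4 : Real.exp x * Real.exp (-x) = 1 := by rw [← Real.exp_add]; simp
      rw [hw, mul_pow, mul_pow, h3, ← pow_mul, mul_comm (n + 1) 2]
      have h5 : p ^ (2 * (n + 1)) * ((1 / p) ^ (n + 1)) ^ 2 = 1 := by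
        rw [← pow_mul, mul_comm (n + 1) 2, ← mul_pow, mul_one_div_cancel hp0.ne', one_pow]
      linear_combination (-Real.exp (-x)) * h4 - Real.exp x * Real.exp (-x) ^ 2 * h5
    rw [e2, Real.sqrt_mul (by positivity), Real.sqrt_sq (by positivity), Real.sqrt_eq_rpow,
      neg_mul, Real.exp_neg, show (-1 / 2 : ℝ) = -(1 / 2) by ring, Real.rpow_neg (by positivity)]
    field_simp
    rw [← mul_pow, one_div_mul_cancel hp0.ne', one_pow]
  rw [e1] at h
  refine hasSum_of_eq h fun l => ?_
  have e3 : Real.exp (-(1 / 2 + 2 * l) * x) = Real.exp (-(1 / 2) * x) * Real.exp (-x) ^ (2 * l) := by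
    rw [← Real.exp_nat_mul, ← Real.exp_add]
    congr 1
    push_cast
    ring
  rw [e3, hw]
  ring

/-- Domination by a geometric series of ratio (e^r/p)², which is where r < log p enters. -/
theorem summable_primeCoeff_mul_exp {p r : ℝ} (hp : 1 < p) (hr : r < Real.log p) :
    Summable fun l => |primeCoeff (1 / p) l| * Real.exp (|-(1 / 2 + 2 * (l : ℝ))| * r) := by
  have hp0 : 0 < p := by linarith
  have hq1 : 1 / p < 1 := by rw [div_lt_one hp0]; exact hp
  have hq0 : 0 < 1 / p := by positivity
  set q := 1 / p
  have hs : Real.exp r * q < 1 := by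
    have : Real.exp r < p := by rwa [← Real.lt_log_iff_exp_lt hp0]
    calc Real.exp r * q < p * q := by gcongr
      _ = 1 := mul_one_div_cancel hp0.ne'
  have hg : Summable fun l : ℕ => q / (1 - q) * Real.exp (1 / 2 * r) * ((Real.exp r * q) ^ 2) ^ l :=
    (summable_geometric_of_lt_one (by positivity)
      (pow_lt_one₀ (by positivity) hs two_ne_zero)).mul_left _
  refine Summable.of_nonneg_of_le (fun l => by positivity) (fun l => ?_) hg
  have h1 : |primeCoeff q l| ≤ q ^ (2 * l + 1) / (1 - q) := by
    have h2 : q ^ (2 * l + 1) ≤ q := pow_le_of_le_one hq0.le hq1.le (by omega)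
    have h3 : 0 < 1 - q := by linarith
    have h4 : 0 < 1 - q ^ (2 * l + 1) := by linarith
    rw [primeCoeff, abs_mul, abs_of_pos (show 0 < q ^ (2 * l + 1) / (1 - q ^ (2 * l + 1)) by
      positivity)]
    refine (mul_le_of_le_one_left (by positivity) (abs_alpha_le l)).trans ?_
    gcongr
  have h2 : Real.exp (|-(1 / 2 + 2 * (l : ℝ))| * r) =
      Real.exp (1 / 2 * r) * Real.exp r ^ (2 * l) := by
    rw [abs_neg, abs_of_pos (by positivity), ← Real.exp_nat_mul, ← Real.exp_add]
    congr 1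
    push_cast
    ring
  rw [h2]
  calc |primeCoeff q l| * (Real.exp (1 / 2 * r) * Real.exp r ^ (2 * l))
      ≤ q ^ (2 * l + 1) / (1 - q) * (Real.exp (1 / 2 * r) * Real.exp r ^ (2 * l)) := by gcongr
    _ = _ := by ring

/-- The sums over the powers of p and over the binomial series are exchanged; the former is
geometric and produces the Lambert factor. -/
theorem primeGen_eq_tsum {p x : ℝ} (hp : 1 < p) (hx : |x| < Real.log p) :
    primeGen p x = ∑' l : ℕ, primeCoeff (1 / p) l * Real.exp (-(1 / 2 + 2 * (l : ℝ)) * x) := by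
  have hp0 : 0 < p := by linarith
  have hq1 : 1 / p < 1 := by rw [div_lt_one hp0]; exact hp
  have hq0 : 0 < 1 / p := by positivity
  set q := 1 / p with hq
  let F : ℕ × ℕ → ℝ := fun y => ((-4 : ℝ) ^ y.1)⁻¹ * (y.1.centralBinom : ℝ) *
    (q ^ ((2 * y.1 + 1) * (y.2 + 1)) * Real.exp (-(1 / 2 + 2 * y.1) * x))
  have hgeo : ∀ (c : ℝ) (l : ℕ), HasSum (fun n : ℕ => c * q ^ ((2 * l + 1) * (n + 1)))
      (c * (q ^ (2 * l + 1) / (1 - q ^ (2 * l + 1)))) := by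
    intro c l
    have h1 : q ^ (2 * l + 1) < 1 := pow_lt_one₀ hq0.le hq1 (by omega)
    have := ((hasSum_geometric_of_lt_one (by positivity) h1).mul_left (q ^ (2 * l + 1))).mul_left c
    rw [div_eq_mul_inv]
    simpa only [pow_succ', pow_mul] using this
  have hl : ∀ l : ℕ, HasSum (fun n => F (l, n))
      (primeCoeff q l * Real.exp (-(1 / 2 + 2 * (l : ℝ)) * x)) := by
    intro l
    have := (hgeo (((-4 : ℝ) ^ l)⁻¹ * (l.centralBinom : ℝ)) l).mul_right
      (Real.exp (-(1 / 2 + 2 * (l : ℝ)) * x))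
    refine hasSum_of_eq this fun n => ?_
    simp only [F]
    ring
  have habs : ∀ l : ℕ, HasSum (fun n => |F (l, n)|)
      (|primeCoeff q l| * Real.exp (-(1 / 2 + 2 * (l : ℝ)) * x)) := by
    intro l
    have h1 : q ^ (2 * l + 1) < 1 := pow_lt_one₀ hq0.le hq1 (by omega)
    have := (hgeo |((-4 : ℝ) ^ l)⁻¹ * (l.centralBinom : ℝ)| l).mul_right
      (Real.exp (-(1 / 2 + 2 * (l : ℝ)) * x))
    rw [primeCoeff, abs_mul _ (q ^ (2 * l + 1) / (1 - q ^ (2 * l + 1))),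
      abs_of_nonneg (show 0 ≤ q ^ (2 * l + 1) / (1 - q ^ (2 * l + 1)) from
        div_nonneg (by positivity) (by linarith))]
    refine hasSum_of_eq this fun n => ?_
    simp only [F]
    rw [abs_mul, abs_of_pos (show 0 < q ^ ((2 * l + 1) * (n + 1)) *
      Real.exp (-(1 / 2 + 2 * (l : ℝ)) * x) by positivity)]
    ring
  have hF : Summable F := by
    refine (summable_prod_of_hasSum (fun y => abs_nonneg (F y)) habs ?_).of_abs
    refine Summable.of_nonneg_of_le (fun l => by positivity) (fun l => ?_)
      (summable_primeCoeff_mul_exp hp hx)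
    have h1 := le_abs_self (-(1 / 2 + 2 * (l : ℝ)) * x)
    rw [abs_mul] at h1
    gcongr
  have h1 := hF.hasSum.prod_fiberwise hl
  have h2 := ((Equiv.prodComm ℕ ℕ).hasSum_iff.mpr hF.hasSum).prod_fiberwise
    fun n => hasSum_primeGen_term hp hx n
  rw [h1.tsum_eq, primeGen, h2.tsum_eq]

/-! ### The Hankel determinants -/

/-- Any radius strictly between 0 and log p would serve. -/
theorem summable_primeCoeff_mul_exp_half {p : ℝ} (hp : 1 < p) :
    Summable fun l => |primeCoeff (1 / p) l| *
      Real.exp (|-(1 / 2 + 2 * (l : ℝ))| * (Real.log p / 2).toNNReal) := by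
  have := Real.log_pos hp
  refine summable_primeCoeff_mul_exp hp ?_
  rw [Real.coe_toNNReal _ (by positivity)]
  linarith

theorem toNNReal_log_half_pos {p : ℝ} (hp : 1 < p) : 0 < (Real.log p / 2).toNNReal :=
  Real.toNNReal_pos.mpr (half_pos (Real.log_pos hp))

theorem primeGen_eventuallyEq {p : ℝ} (hp : 1 < p) :
    primeGen p =ᶠ[nhds 0]
      fun x => ∑' l : ℕ, primeCoeff (1 / p) l * Real.exp (-(1 / 2 + 2 * (l : ℝ)) * x) := by
  filter_upwards [Metric.ball_mem_nhds (0 : ℝ) (Real.log_pos hp)] with x hx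
  exact primeGen_eq_tsum hp (by simpa using hx)

theorem contDiffAt_primeGen {p : ℝ} (hp : 1 < p) {n : WithTop ℕ∞} :
    ContDiffAt ℝ n (primeGen p) 0 :=
  ((hasFPowerSeriesOnBall_tsum_exp (toNNReal_log_half_pos hp)
    (summable_primeCoeff_mul_exp_half hp)).analyticAt.contDiffAt).congr_of_eventuallyEq
    (primeGen_eventuallyEq hp)

theorem iteratedDeriv_primeGen {p : ℝ} (hp : 1 < p) (k : ℕ) :
    iteratedDeriv k (primeGen p) 0 =
      ∑' l : ℕ, primeCoeff (1 / p) l * (-(1 / 2 + 2 * (l : ℝ))) ^ k := by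
  rw [(primeGen_eventuallyEq hp).iteratedDeriv_eq k]
  exact iteratedDeriv_tsum_exp (toNNReal_log_half_pos hp) (summable_primeCoeff_mul_exp_half hp) k

theorem evenMoment_eq {p : ℝ} (hp : 1 < p) (k : ℕ) :
    evenMoment p k = archEvenMoment k +
      (-1) ^ k * (2 * ∑' l : ℕ, primeCoeff (1 / p) l * (1 / 2 + 2 * (l : ℝ)) ^ (2 * k)) := by
  have h2 : ContDiffAt ℝ ((2 * k : ℕ) : WithTop ℕ∞) (fun x => primeGen p (-x)) 0 := by
    refine ContDiffAt.comp (g := primeGen p) (f := fun x : ℝ => -x) 0 ?_ (by fun_prop)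
    rw [neg_zero]
    exact contDiffAt_primeGen hp
  have h1 : ContDiffAt ℝ ((2 * k : ℕ) : WithTop ℕ∞) (archGen + primeGen p) 0 :=
    contDiff_archGen.contDiffAt.add (contDiffAt_primeGen hp)
  have e := iteratedDeriv_add h1 h2
  rw [iteratedDeriv_add contDiff_archGen.contDiffAt (contDiffAt_primeGen hp),
    iteratedDeriv_comp_neg, neg_zero, iteratedDeriv_primeGen hp, (even_two_mul k).neg_one_pow,
    one_smul] at e
  simp only [(even_two_mul k).neg_pow] at e
  rw [evenMoment, archEvenMoment, ← mul_add]
  congr 1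
  refine Eq.trans e ?_
  ring

/-- The nodes `-i(1/2 + 2l)`. -/
noncomputable def node (l : ℕ) : ℂ := -Complex.I * (1 / 2 + 2 * (l : ℂ))

/-- The operator i∂ has eigenvalue `node l` on e^{-(1/2+2l)x} and -`node l` on e^{(1/2+2l)x}, the
exponentials occurring in Σ_p(x) and Σ_p(-x). -/
theorem hasSum_momentFunctional_sub {p : ℝ} (hp : 1 < p) (P : Polynomial ℂ) :
    HasSum (fun l => (primeCoeff (1 / p) l : ℂ) * (P.eval (node l) + P.eval (-node l)))
      (momentFunctional (fullMoment (evenMoment p)) P -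
        momentFunctional (fullMoment archEvenMoment) P) := by
  induction P using Polynomial.induction_on' with
  | add P Q hP hQ =>
    rw [map_add, map_add, add_sub_add_comm]
    refine hasSum_of_eq (hP.add hQ) fun l => ?_
    rw [Polynomial.eval_add, Polynomial.eval_add]
    ring
  | monomial k a =>
    simp only [momentFunctional_monomial, Polynomial.eval_monomial, fullMoment]
    rcases Nat.even_or_odd k with hk | hk
    · rw [if_pos hk, if_pos hk, evenMoment_eq hp]
      obtain ⟨j, rfl⟩ := hk
      rw [← two_mul, Nat.mul_div_cancel_left j two_pos]
      have h1 : Summable fun l : ℕ => primeCoeff (1 / p) l * (1 / 2 + 2 * (l : ℝ)) ^ (2 * j) := by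
        have h := summable_mul_pow_of_exp (r := (Real.log p / 2).toNNReal)
          (by exact_mod_cast toNNReal_log_half_pos hp) (summable_primeCoeff_mul_exp_half hp) (2 * j)
        simp only [(even_two_mul j).neg_pow] at h
        exact h.of_abs
      have h2 := (Complex.ofRealCLM.hasSum h1.hasSum).mul_left (a * (-1) ^ j * 2)
      have e : a * ((archEvenMoment j + (-1) ^ j * (2 * ∑' l : ℕ,
          primeCoeff (1 / p) l * (1 / 2 + 2 * (l : ℝ)) ^ (2 * j)) : ℝ) : ℂ) -
          a * (archEvenMoment j : ℂ) = a * (-1) ^ j * 2 * Complex.ofRealCLM (∑' l : ℕ,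
          primeCoeff (1 / p) l * (1 / 2 + 2 * (l : ℝ)) ^ (2 * j)) := by
        rw [Complex.ofRealCLM_apply, Complex.ofReal_add, Complex.ofReal_mul, Complex.ofReal_mul]
        push_cast
        ring
      rw [e]
      refine hasSum_of_eq h2 fun l => ?_
      have h3 : node l ^ (2 * j) = (-1) ^ j * (1 / 2 + 2 * (l : ℂ)) ^ (2 * j) := by
        rw [node, mul_pow, (even_two_mul j).neg_pow, pow_mul, Complex.I_sq]
      rw [(even_two_mul j).neg_pow, h3, Complex.ofRealCLM_apply]
      push_cast
      ring
    · rw [if_neg (Nat.not_even_iff_odd.mpr hk), if_neg (Nat.not_even_iff_odd.mpr hk), sub_self]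
      refine hasSum_of_eq hasSum_zero fun l => ?_
      rw [hk.neg_pow]
      ring

theorem ofReal_primeCoeff (q : ℝ) (l : ℕ) :
    (primeCoeff q l : ℂ) = alpha l * ((q : ℂ) ^ (2 * l + 1) / (1 - (q : ℂ) ^ (2 * l + 1))) := by
  rw [primeCoeff, Complex.ofReal_mul, ofReal_alpha]
  push_cast
  rfl

/-- The coefficient of `q ^ (2l+1) / (1 - q ^ (2l+1))` in the normalised Hankel matrix. -/
noncomputable def hankelCoeff (i j l : ℕ) : ℂ :=
  (1 + (-1) ^ (i + j)) * ((√2 : ℝ) : ℂ) * ((-4 : ℂ) ^ i)⁻¹ *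
    (alpha l * (i.centralBinom : ℂ) * (meixner j l * meixner i l : ℂ))

theorem polyGrowth_hankelCoeff (i j : ℕ) : PolyGrowth (hankelCoeff i j) :=
  (polyGrowth_const _).mul ((polyGrowth_alpha.mul (polyGrowth_const _)).mul
    ((polyGrowth_meixner j).mul (polyGrowth_meixner i)))

/-- Dividing the rows by the squared norms, instead of rows and columns by the norms, introduces no
new square root. -/
theorem hankelCoeff_mem (i j l : ℕ) : hankelCoeff i j l ∈ intInvSqrtTwo :=
  mul_mem (mul_mem (mul_mem (add_mem (one_mem _) (pow_mem (neg_mem (one_mem _)) _))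
    sqrt_two_mem_intInvSqrtTwo) (inv_neg_four_pow_mem half_mem_intInvSqrtTwo i))
    (alpha_mul_meixner_mem j i l)

/-- The perturbation of the identity which is the Gram matrix of the normalised polynomials. -/
noncomputable def hankelPerturbation (n : ℕ) (q : ℂ) : Matrix (Fin (n + 1)) (Fin (n + 1)) ℂ :=
  Matrix.of fun i j => ∑' l, hankelCoeff i j l * (q ^ (2 * l + 1) / (1 - q ^ (2 * l + 1)))

/-- The squared norm of `meixnerPoly m` for the archimedean moments. -/
noncomputable def archNorm (m : ℕ) : ℂ := ((1 / √2 : ℝ) : ℂ) * meixnerNorm m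

theorem archNorm_ne_zero (m : ℕ) : archNorm m ≠ 0 := by
  have h1 : (m.centralBinom : ℂ) ≠ 0 := by exact_mod_cast m.centralBinom_ne_zero
  have h2 : ((1 / √2 : ℝ) : ℂ) ≠ 0 := by
    rw [Complex.ofReal_ne_zero]
    positivity
  exact mul_ne_zero h2 (div_ne_zero (pow_ne_zero _ (by norm_num)) h1)

theorem archNorm_mul_hankelCoeff (i j l : ℕ) :
    archNorm i * hankelCoeff i j l =
      alpha l * (1 + (-1) ^ (i + j)) * (meixner i l * meixner j l : ℂ) := by
  have h1 : (i.centralBinom : ℂ) ≠ 0 := by exact_mod_cast i.centralBinom_ne_zero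
  have h2 : ((√2 : ℝ) : ℂ) ≠ 0 := by
    rw [Complex.ofReal_ne_zero]
    positivity
  have h3 : ((-4 : ℂ) ^ i) ≠ 0 := pow_ne_zero _ (by norm_num)
  rw [archNorm, meixnerNorm, hankelCoeff, Complex.ofReal_div, Complex.ofReal_one]
  field_simp

/-- Parity turns the sum of the values at a node and its opposite into the factor 1 + (-1)^(i+j). -/
theorem momentFunctional_evenMoment_mul {p : ℝ} (hp : 1 < p) {n : ℕ} (i j : Fin (n + 1)) :
    momentFunctional (fullMoment (evenMoment p)) (meixnerPoly i * meixnerPoly j) =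
      archNorm i * (1 + hankelPerturbation n ((1 / p : ℝ) : ℂ)) i j := by
  have h := (hasSum_momentFunctional_sub hp (meixnerPoly i * meixnerPoly j)).tsum_eq
  rw [momentFunctional_arch_mul] at h
  rw [Matrix.add_apply, Matrix.one_apply, hankelPerturbation, Matrix.of_apply, mul_add,
    ← tsum_mul_left, ← sub_eq_iff_eq_add']
  convert h.symm using 1
  · congr 1
    simp only [Fin.ext_iff, archNorm]
    split_ifs <;> ring
  · refine tsum_congr fun l => ?_
    rw [← mul_assoc, archNorm_mul_hankelCoeff, ofReal_primeCoeff, Polynomial.eval_mul,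
      Polynomial.eval_mul, meixnerPoly_eval_neg, meixnerPoly_eval_neg, node, meixnerPoly_eval,
      meixnerPoly_eval, pow_add]
    ring

theorem det_coeffMatrix_mul_hankelDet {p : ℝ} (hp : 1 < p) (n : ℕ) :
    (coeffMatrix n meixnerPoly).det ^ 2 * (hankelDet p n : ℂ) =
      (∏ i : Fin (n + 1), archNorm i) * (1 + hankelPerturbation n ((1 / p : ℝ) : ℂ)).det := by
  rw [hankelDet, det_coeffMatrix_mul_evenHankel _ _ _ natDegree_meixnerPoly_le,
    ← Matrix.det_mul_column]
  simp only [momentFunctional_evenMoment_mul hp]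

theorem det_coeffMatrix_mul_hankelDetZero (n : ℕ) :
    (coeffMatrix n meixnerPoly).det ^ 2 * (hankelDetZero n : ℂ) =
      ∏ i : Fin (n + 1), archNorm i := by
  rw [hankelDetZero, det_coeffMatrix_mul_evenHankel _ _ _ natDegree_meixnerPoly_le,
    ← Matrix.det_diagonal]
  congr 1
  ext i j
  simp only [Matrix.of_apply, momentFunctional_arch_mul, Matrix.diagonal_apply, Fin.ext_iff,
    archNorm]

theorem hankelDetZero_ne_zero (n : ℕ) : hankelDetZero n ≠ 0 := by
  intro h
  have h1 := det_coeffMatrix_mul_hankelDetZero n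
  rw [h, Complex.ofReal_zero, mul_zero] at h1
  exact Finset.prod_ne_zero_iff.mpr (fun i _ => archNorm_ne_zero (i : Fin (n + 1))) h1.symm

theorem hankelDet_div {p : ℝ} (hp : 1 < p) (n : ℕ) :
    ((hankelDet p n / hankelDetZero n : ℝ) : ℂ) =
      (1 + hankelPerturbation n ((1 / p : ℝ) : ℂ)).det := by
  have h0 : (hankelDetZero n : ℂ) ≠ 0 := Complex.ofReal_ne_zero.mpr (hankelDetZero_ne_zero n)
  have h1 := det_coeffMatrix_mul_hankelDetZero n
  have h2 := det_coeffMatrix_mul_hankelDet hp n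
  -- The base change is invertible because the product of the archimedean norms is nonzero; leading
  -- coefficients are not needed.
  have h3 : (coeffMatrix n meixnerPoly).det ^ 2 ≠ 0 := by
    intro h
    rw [h, zero_mul] at h1
    exact Finset.prod_ne_zero_iff.mpr (fun i _ => archNorm_ne_zero (i : Fin (n + 1))) h1.symm
  rw [Complex.ofReal_div, div_eq_iff h0]
  apply mul_left_cancel₀ h3
  rw [h2, ← h1]
  ring

theorem hasQExpansionIn_det_hankelPerturbation (n : ℕ) :
    HasQExpansionIn intInvSqrtTwo (fun q => (1 + hankelPerturbation n q).det) := by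
  refine HasQExpansionIn.det fun i j => HasQExpansionIn.add (HasQExpansionIn.const ?_)
    ((polyGrowth_hankelCoeff i j).hasQExpansionIn_lambert (hankelCoeff_mem i j))
  rw [Matrix.one_apply]
  split_ifs
  exacts [one_mem _, zero_mem _]

end Semilocal

theorem mainTheorem1 (n : ℕ) :
    (∀ i j : Fin (n + 1), Semilocal.HasQExpansionIn Semilocal.cyclotomicIntegersHalf
        (fun q => Semilocal.gammaMatrix n q i j)) ∧
    (∀ m : ℕ,
      Semilocal.HasQExpansionIn Semilocal.intInvSqrtTwo
        (fun q => Semilocal.traceWedge m (Semilocal.APlus n q)) ∧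
      Semilocal.HasQExpansionIn Semilocal.intInvSqrtTwo
        (fun q => Semilocal.traceWedge m (Semilocal.AMinus n q))) ∧
    (Semilocal.hankelDetZero n ≠ 0 ∧
      ∃ a : ℕ → ℂ, (∀ k, a k ∈ Semilocal.intInvSqrtTwo) ∧
        ∀ p : ℝ, 1 < p →
          HasSum (fun k => a k * ((1 / p : ℝ) : ℂ) ^ k)
            ((Semilocal.hankelDet p n / Semilocal.hankelDetZero n : ℝ) : ℂ)) := by
  refine ⟨Semilocal.hasQExpansionIn_gammaMatrix n, fun m =>
    ⟨Semilocal.hasQExpansionIn_traceWedge_APlus n m,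
      Semilocal.hasQExpansionIn_traceWedge_AMinus n m⟩, Semilocal.hankelDetZero_ne_zero n, ?_⟩
  obtain ⟨a, ha, h⟩ := Semilocal.hasQExpansionIn_det_hankelPerturbation n
  refine ⟨a, ha, fun p hp => ?_⟩
  rw [Semilocal.hankelDet_div hp]
  refine h _ ?_
  have hp0 : 0 < p := one_pos.trans hp
  rw [Complex.norm_real, Real.norm_of_nonneg (by positivity), div_lt_one hp0]
  exact hp
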